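/- **Theorem.** Setting. Let $d\ge 1$ and let $r,R,G,M$ be constants with $r,R>0$. Let $\mathcal K\subseteq\mathbb R^d$ be a closed convex set with $r\mathcal B^d\subseteq\mathcal K\subseteq R\mathcal B^d$, where $\mathcal B^d$ is the unit Euclidean ball centred at the origin. There are $n$ learners, the nodes of an undirected graph $(V,E)$ with $V=\{1,\dots,n\}$ (loops allowed), $N_i=\{j:(i,j)\in E\}$. Let $P\in\mathbb R^{n\times n}$ be entrywise non-negative, symmetric and doubly stochastic, with $P_{ij}>0$ only if $(i,j)\in E$, and with second largest singular value $\sigma_2(P)<1$ (counted with multiplicity; $\sigma_2(P)=0$ if $n=1$). In each round $t=1,\dots,T$ and for each $j\in V$ there is a loss $f_{t,j}:\mathcal K\to\mathbb R$ that is convex, $G$-Lipschitz and satisfies $|f_{t,j}|\le M$ on $\mathcal K$; all losses are fixed before the game starts (oblivious adversary). Put $f_t=\sum_{j=1}^n f_{t,j}$. If learner $i$ plays $\mathbf y_i(1),\dots,\mathbf y_i(T)$, its regret is $R_{T,i}=\sum_{t=1}^T f_t(\mathbf y_i(t))-\min_{\mathbf x\in\mathcal K}\sum_{t=1}^T f_t(\mathbf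 x)$. Algorithm D-BBCG, with parameters $\alpha,h,L,K,\delta$ ($0<\delta\le r$, $K\mid T$) and a starting point $\mathbf x_{\rm in}\in\mathcal K_\delta:=(1-\delta/r)\mathcal K$. Set $\mathbf x_i(1)=\mathbf x_{\rm in}$ and $\mathbf z_i(1)=\mathbf 0$ for all $i$. For each block $m=1,\dots,T/K$, each learner $i$ plays, in the rounds $t=(m-1)K+1,\dots,mK$, the point $\mathbf y_i(t)=\mathbf x_i(m)+\delta\mathbf u_i(t)$, where all $\mathbf u_i(t)$ are independent and uniform on the unit sphere of $\mathbb R^d$, observes only the number $f_{t,i}(\mathbf y_i(t))$ and forms $\mathbf g_i(t)=\frac d\delta f_{t,i}(\mathbf y_i(t))\mathbf u_i(t)$. With $\widehat{\mathbf g}_i(m)$ the sum of $\mathbf g_i(t)$ over the block and $F_{m,i}(\mathbf x)=\mathbf z_i(m)^\top\mathbf x+\frac{(m-1)\alpha K}{2}\|\mathbf x\|_2^2+h\|\mathbf x-\mathbf x_{\rm in}\|_2^2$, it then sets $$\mathbf x_i(m+1)=\mathrm{CG}(\mathcal K_\delta,L,F_{m,i},\mathbf x_i(m)),\qquad \mathbf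 z_i(m+1)=\sum_{j\in N_i}P_{ij}\mathbf z_j(m)+\widehat{\mathbf g}_i(m)-\alpha K\mathbf x_i(m),$$ where the vectors $\mathbf z_j(m)$ are exchanged between neighbours in one communication round per block. Here $\mathrm{CG}(S,L,F,\mathbf c_0)=\mathbf c_L$ with $\mathbf c_{\tau+1}=\mathbf c_\tau+s_\tau(\mathbf v_\tau-\mathbf c_\tau)$, $\mathbf v_\tau\in\operatorname{argmin}_{\mathbf x\in S}\nabla F(\mathbf c_\tau)^\top\mathbf x$, $s_\tau\in\operatorname{argmin}_{s\in[0,1]}F(\mathbf c_\tau+s(\mathbf v_\tau-\mathbf c_\tau))$; ties are broken by arbitrary measurable rules, possibly randomized, that do not depend on later directions $\mathbf u_i(t)$. Claim. For every constant $c>0$ there is a constant $C$, depending only on $d,G,M,r,R,c$, such that for all $n$, $(V,E)$, $P$, $\mathcal K$, losses and $\mathbf x_{\rm in}$ as above and all $T\ge1$ for which $\sqrt T$ is an integer and $cT^{-1/4}\le r$, D-BBCG with $$\alpha=0,\qquad K=L=\sqrt T,\qquad h=\frac{n^{1/4}dMT^{3/4}}{\sqrt{1-\sigma_2(P)}\,R},\qquad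 \delta=cT^{-1/4}$$ satisfies, for every learner $i\in V$, $$\mathbb E[R_{T,i}]\le C\,n^{5/4}(1-\sigma_2(P))^{-1/2}\,T^{3/4},$$ and it uses at most $\sqrt T$ communication rounds. -/

import Mathlib

open MeasureTheory ProbabilityTheory
open scoped RealInnerProductSpace Gradient Pointwise

namespace BanditCG

/-- The Euclidean space `ℝ^d`. -/
abbrev Vec (d : ℕ) : Type := EuclideanSpace ℝ (Fin d)

/-- The unit sphere `S^d` of `ℝ^d`. -/
abbrev Sph (d : ℕ) : Type := Metric.sphere (0 : Vec d) 1

/-- The uniform distribution on the unit sphere: normalized surface measure. -/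
noncomputable def uniformSphere (d : ℕ) : Measure (Sph d) :=
  ((volume : Measure (Vec d)).toSphere Set.univ)⁻¹ • (volume : Measure (Vec d)).toSphere

/-! ### The problem: decision set, network, losses, regret -/

/-- `𝒦` is a closed convex set with `r 𝓑 ⊆ 𝒦 ⊆ R 𝓑`. With `r > 0` it contains the origin
in its interior, so it is full dimensional. -/
structure IsDecisionSet {d : ℕ} (r R : ℝ) (𝒦 : Set (Vec d)) : Prop where
  closed : IsClosed 𝒦
  convex : Convex ℝ 𝒦
  inner_ball : Metric.closedBall 0 r ⊆ 𝒦
  outer_ball : 𝒦 ⊆ Metric.closedBall 0 R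

/-- The second largest singular value `σ₂(P)`, counted with multiplicity. Mathlib numbers the
singular values from zero, in decreasing order; for a `1 × 1` matrix this gives `0`. -/
noncomputable def sigma2 {n : ℕ} (P : Matrix (Fin n) (Fin n) ℝ) : ℝ :=
  (Matrix.toEuclideanLin P).singularValues 1

/-- `P` is a symmetric doubly stochastic weight matrix supported on the undirected graph on
`{1, …, n}` with edge relation `E` (loops are allowed), with `σ₂(P) < 1`. -/
structure IsWeightMatrix {n : ℕ} (E : Fin n → Fin n → Prop) (P : Matrix (Fin n) (Fin n) ℝ) :
    Prop where
  undirected : ∀ i j, E i j → E j i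
  supported : ∀ i j, 0 < P i j → E i j
  symm : P.IsSymm
  stochastic : P ∈ doublyStochastic ℝ (Fin n)
  gap : sigma2 P < 1

/-- The neighbours `N_i = {j | (i, j) ∈ E}`. -/
noncomputable def neighbors {n : ℕ} (E : Fin n → Fin n → Prop) (i : Fin n) : Finset (Fin n) :=
  open Classical in Finset.univ.filter (E i)

/-- The local losses `f t i`, for rounds `t = 1, …, T` and learners `i`: convex, `G`-Lipschitz
and bounded by `M` in absolute value on `𝒦`. They are fixed functions, chosen before the
game (oblivious adversary). Their values outside `𝒦` play no role. -/
structure IsLossSequence {d n : ℕ} (𝒦 : Set (Vec d)) (G M : ℝ) (T : ℕ)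
    (f : ℕ → Fin n → Vec d → ℝ) : Prop where
  convex : ∀ t ∈ Finset.Icc 1 T, ∀ i, ConvexOn ℝ 𝒦 (f t i)
  lipschitz : ∀ t ∈ Finset.Icc 1 T, ∀ i, ∀ x ∈ 𝒦, ∀ y ∈ 𝒦, |f t i x - f t i y| ≤ G * ‖x - y‖
  bounded : ∀ t ∈ Finset.Icc 1 T, ∀ i, ∀ x ∈ 𝒦, |f t i x| ≤ M

/-- The global loss `f_t(x) = ∑_j f_{t,j}(x)`. -/
def globalLoss {d n : ℕ} (f : ℕ → Fin n → Vec d → ℝ) (t : ℕ) (x : Vec d) : ℝ :=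
  ∑ j, f t j x

/-- The regret of a sequence of decisions `y 1, …, y T`, measured by the global loss against
the best fixed decision in `𝒦`. -/
noncomputable def regret {d n : ℕ} (𝒦 : Set (Vec d)) (T : ℕ) (f : ℕ → Fin n → Vec d → ℝ)
    (y : ℕ → Vec d) : ℝ :=
  ∑ t ∈ Finset.Icc 1 T, globalLoss f t (y t)
    - sInf ((fun x => ∑ t ∈ Finset.Icc 1 T, globalLoss f t x) '' 𝒦)

/-! ### The conditional gradient subroutine -/

/-- `c 0, …, c L` are the iterates of `L` steps of conditional gradient with line search for
minimizing `F` over `S`, started at `x₀`, with vertices `v τ` and step sizes `s τ`. Every way of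
breaking ties in the two `argmin`s is allowed. The output is `c L`. -/
structure IsCGRun {d : ℕ} (S : Set (Vec d)) (L : ℕ) (F : Vec d → ℝ) (x₀ : Vec d)
    (c v : ℕ → Vec d) (s : ℕ → ℝ) : Prop where
  init : c 0 = x₀
  vertex_mem : ∀ τ < L, v τ ∈ S
  vertex_min : ∀ τ < L, IsMinOn (fun x => ⟪∇ F (c τ), x⟫) S (v τ)
  search_mem : ∀ τ < L, s τ ∈ Set.Icc (0 : ℝ) 1
  search_min : ∀ τ < L,
    IsMinOn (fun a : ℝ => F (c τ + a • (v τ - c τ))) (Set.Icc (0 : ℝ) 1) (s τ)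
  step : ∀ τ < L, c (τ + 1) = c τ + s τ • (v τ - c τ)

/-! ### D-BBCG -/

/-- The parameters of D-BBCG: horizon `T`, block size `K`, number `L` of linear optimization
steps per block, and the reals `α`, `h`, `δ`. -/
structure Params where
  T : ℕ
  K : ℕ
  L : ℕ
  α : ℝ
  h : ℝ
  δ : ℝ

/-- The number `B = T / K` of blocks. -/
def Params.B (p : Params) : ℕ := p.T / p.K

/-- The rounds `(m - 1) K + 1, …, m K` of block `m`. -/
def Params.rounds (p : Params) (m : ℕ) : Finset ℕ :=
  Finset.Icc ((m - 1) * p.K + 1) (m * p.K)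

/-- The block that contains round `t ≥ 1`. -/
def Params.blockOf (p : Params) (t : ℕ) : ℕ := (t - 1) / p.K + 1

/-- The shrunk set `𝒦_δ = (1 - δ / r) 𝒦`. -/
def shrink {d : ℕ} (r δ : ℝ) (𝒦 : Set (Vec d)) : Set (Vec d) := (1 - δ / r) • 𝒦

/-- The surrogate loss `F_{m,i}(x) = zᵀ x + (m - 1) α K / 2 ‖x‖² + h ‖x - x₀‖²`, where `z` is
the value of `z_i(m)`. -/
noncomputable def Params.surrogate {d : ℕ} (p : Params) (x₀ : Vec d) (m : ℕ) (z : Vec d) :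
    Vec d → ℝ :=
  fun x => ⟪z, x⟫ + ((m : ℝ) - 1) * p.α * p.K / 2 * ‖x‖ ^ 2 + p.h * ‖x - x₀‖ ^ 2

/-- The random variables of an execution with `n` learners in `ℝ^d`: the directions `u i t`, the
centres `x i m`, the dual vectors `z i m`, the inner iterates `c i m τ`, vertices `v i m τ` and
step sizes `s i m τ` of the conditional gradient call in block `m`, and the history `ℋ t` of
everything that has happened up to the end of round `t`. -/
structure Execution (d n : ℕ) (Ω : Type*) [mΩ : MeasurableSpace Ω] where
  u : Fin n → ℕ → Ω → Sph d
  x : Fin n → ℕ → Ω → Vec d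
  z : Fin n → ℕ → Ω → Vec d
  c : Fin n → ℕ → ℕ → Ω → Vec d
  v : Fin n → ℕ → ℕ → Ω → Vec d
  s : Fin n → ℕ → ℕ → Ω → ℝ
  ℋ : Filtration ℕ mΩ

namespace Execution

variable {d n : ℕ} {Ω : Type*} [MeasurableSpace Ω]

/-- The decision `y_i(t) = x_i(m) + δ u_i(t)` played in round `t` of block `m`. -/
noncomputable def y (e : Execution d n Ω) (p : Params) (i : Fin n) (t : ℕ) (ω : Ω) : Vec d :=
  e.x i (p.blockOf t) ω + p.δ • (e.u i t ω : Vec d)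

/-- The one-point gradient estimate `g_i(t) = (d / δ) f_{t,i}(y_i(t)) u_i(t)`. -/
noncomputable def g (e : Execution d n Ω) (p : Params) (f : ℕ → Fin n → Vec d → ℝ)
    (i : Fin n) (t : ℕ) (ω : Ω) : Vec d :=
  ((d : ℝ) / p.δ * f t i (e.y p i t ω)) • (e.u i t ω : Vec d)

/-- The sum of the gradient estimates over block `m`. -/
noncomputable def gHat (e : Execution d n Ω) (p : Params) (f : ℕ → Fin n → Vec d → ℝ)
    (i : Fin n) (m : ℕ) (ω : Ω) : Vec d :=
  ∑ t ∈ p.rounds m, e.g p f i t ω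

/-- The message that learner `j` sends to learner `i` in round `t`: in the last round `t = m K`
of a block, `j` sends `z_j(m)` to its neighbours; otherwise nothing is sent. -/
noncomputable def msg (e : Execution d n Ω) (p : Params) (E : Fin n → Fin n → Prop)
    (t : ℕ) (j i : Fin n) (ω : Ω) : Option (Vec d) :=
  open Classical in if p.K ∣ t ∧ E j i then some (e.z j (t / p.K) ω) else none

/-- The communication rounds: the rounds in which some message is sent. -/
def commRounds (e : Execution d n Ω) (p : Params) (E : Fin n → Fin n → Prop) : Set ℕ :=
  {t | t ∈ Finset.Icc 1 p.T ∧ ∃ (j i : Fin n) (ω : Ω), e.msg p E t j i ω ≠ none}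

/-- `e` is an execution of D-BBCG on the losses `f` with parameters `p`, weight matrix `P` on
the graph `E`, decision set `𝒦` with inner radius `r`, and starting point `x₀`. -/
structure IsDBBCG (e : Execution d n Ω) (μ : Measure Ω) (p : Params)
    (E : Fin n → Fin n → Prop) (P : Matrix (Fin n) (Fin n) ℝ) (𝒦 : Set (Vec d)) (r : ℝ)
    (f : ℕ → Fin n → Vec d → ℝ) (x₀ : Vec d) : Prop where
  /-- The directions are uniform on the sphere, -/
  u_law : ∀ t ∈ Finset.Icc 1 p.T, ∀ i, HasLaw (e.u i t) (uniformSphere d) μ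
  /-- independent between learners, -/
  u_indep : ∀ t ∈ Finset.Icc 1 p.T, iIndepFun (fun i => e.u i t) μ
  /-- part of the history once they are drawn, -/
  u_history : ∀ t ∈ Finset.Icc 1 p.T, ∀ i, Measurable[e.ℋ t] (e.u i t)
  /-- and drawn afresh: those of round `t` are jointly independent of the history before it. -/
  u_fresh : ∀ t ∈ Finset.Icc 1 p.T,
    Indep (⨆ i, MeasurableSpace.comap (e.u i t) inferInstance) (e.ℋ (t - 1)) μ
  /-- Ties in block `m` are broken by (measurable, possibly randomized) rules that do not look
  beyond the end of that block. -/
  v_history : ∀ m ∈ Finset.Icc 1 p.B, ∀ i, ∀ τ < p.L, Measurable[e.ℋ (m * p.K)] (e.v i m τ)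
  s_history : ∀ m ∈ Finset.Icc 1 p.B, ∀ i, ∀ τ < p.L, Measurable[e.ℋ (m * p.K)] (e.s i m τ)
  x_init : ∀ i ω, e.x i 1 ω = x₀
  z_init : ∀ i ω, e.z i 1 ω = 0
  /-- `x_i(m + 1) = CG(𝒦_δ, L, F_{m,i}, x_i(m))` -/
  cg : ∀ m ∈ Finset.Icc 1 p.B, ∀ i ω,
    IsCGRun (shrink r p.δ 𝒦) p.L (p.surrogate x₀ m (e.z i m ω)) (e.x i m ω)
      (fun τ => e.c i m τ ω) (fun τ => e.v i m τ ω) (fun τ => e.s i m τ ω)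
  x_step : ∀ m ∈ Finset.Icc 1 p.B, ∀ i ω, e.x i (m + 1) ω = e.c i m p.L ω
  /-- `z_i(m + 1) = ∑_{j ∈ N_i} P_{ij} z_j(m) + ĝ_i(m) - α K x_i(m)`, where `z_j(m)` is received
  from `j` as the message of round `m K`. -/
  z_step : ∀ m ∈ Finset.Icc 1 p.B, ∀ i ω,
    e.z i (m + 1) ω = ∑ j ∈ neighbors E i, P i j • (e.msg p E (m * p.K) j i ω).getD 0
      + e.gHat p f i m ω - (p.α * p.K) • e.x i m ω

end Execution

end BanditCG

/-!
Write `σ = σ₂(P)` and let the *leader* of block `m` be the minimizer over `𝒦_δ` of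
`⟪z̄(m), x⟫ + h ‖x - x₀‖²`, where `z̄(m)` is the average of the dual vectors. Since `P` is doubly
stochastic, `z̄` accumulates the averages of the block estimates `ĝ_j(m)`, so the leader plays
follow-the-regularized-leader on them: its linearized regret is at most
`n (4 h R² + ∑ₘ ‖avg ĝ(m)‖² / (4 h))` (`sum_inner_regMin_le`, `sum_integral_inner_leader_le`).
The real decisions are compared with the leader.

* The estimate `g` is, up to `2 G δ`, a subgradient on average:
  `(d / δ) 𝔼 f(x + δ u) ⟪u, x - x'⟫ ≥ f(x) - f(x') - 2 G δ` (`sub_le_integral_estimator`). Instead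
  of Stokes' theorem, the proof integrates the convexity inequality for `f(x + v) - f(x + v - s w)`
  with `w = x - x'` against a radial bump in `v`. Moving the translation to the bump, letting
  `s → 0` and then concentrating the gradient of the bump near the sphere of radius `δ` gives the
  claim. The conditional mean of `g` has norm at most `d G` (`integral_estimator_le`), since
  constants integrate to zero against `u`.
* Hence the `K` estimates of a block are a martingale up to a drift of `d G` each, and the root
  mean square of `ĝ_j(m)` is at most `√K d M / δ + K d G` (`integral_norm_gHat_sq_le`), which is of
  order `√T`.
* Mixing contracts the distance from consensus by `σ` (`stackNorm_mix_add_sub_avg_le`), because the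
  eigenvalue `1` of `P²` is simple with the constant eigenvector and all others are at most `σ²`. A
  geometric series bounds the expected disagreement by `√n √T / (1 - σ)`, up to a constant.
* The objective is strongly convex, so its minimizer is a Lipschitz function of the dual vector, and
  `K` steps of conditional gradient come within `4 R / √K` of it from every start
  (`IsCGRun.norm_sub_sq_le`). Together these bound the distance of the centres from the leader
  (`integral_norm_x_sub_leader_le`).

The centres and the leader of a block depend only on earlier blocks. So when `ĝ_j(m)` is paired
with their difference, only its conditional mean enters, and this is what makes the consensus error
affordable. With the prescribed parameters all terms are of the order of
`n^(5/4) (1 - σ)^(-1/2) T^(3/4)` or smaller (`tuned_bound_le`). If `M = 0` then `h = 0` and the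
regret is zero.
-/

namespace BanditCG

/-! ### The uniform distribution on the sphere -/

lemma vec_nontrivial {d : ℕ} (hd : 1 ≤ d) : Nontrivial (Vec d) :=
  Module.nontrivial_of_finrank_pos (R := ℝ) (by simp; omega)

lemma volume_real_ball_pos (d : ℕ) : 0 < (volume : Measure (Vec d)).real (Metric.ball 0 1) :=
  ENNReal.toReal_pos (Metric.measure_ball_pos volume _ one_pos).ne' measure_ball_lt_top.ne

lemma isProbabilityMeasure_uniformSphere {d : ℕ} (hd : 1 ≤ d) :
    IsProbabilityMeasure (uniformSphere d) := by
  have := vec_nontrivial hd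
  refine ⟨?_⟩
  rw [uniformSphere, Measure.smul_apply, smul_eq_mul]
  refine ENNReal.inv_mul_cancel ?_ (measure_ne_top _ _)
  rw [Ne, Measure.measure_univ_eq_zero]
  exact Measure.toSphere_ne_zero _

/-- A function of the direction integrates over a ball to its spherical mean times the volume of
the ball. -/
lemma setIntegral_ball_direction {d : ℕ} (hd : 1 ≤ d) (Φ : Vec d → ℝ) {a : ℝ} (ha : 0 < a) :
    ∫ v in Metric.ball (0 : Vec d) a, Φ (‖v‖⁻¹ • v)
      = a ^ d * (volume : Measure (Vec d)).real (Metric.ball 0 1)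
        * ∫ u : Sph d, Φ u ∂uniformSphere d := by
  have := vec_nontrivial hd
  have hd' : (d : ℝ) ≠ 0 := by positivity
  have hV := volume_real_ball_pos d
  let μ : Measure (Vec d) := volume
  have h1 : ∫ v in Metric.ball (0 : Vec d) a, Φ (‖v‖⁻¹ • v)
      = ∫ v, (Set.Iio a).indicator 1 ‖v‖ * Φ (‖v‖⁻¹ • v) ∂μ := by
    rw [← integral_indicator measurableSet_ball]
    congr 1 with v
    by_cases h : ‖v‖ < a <;> simp [Set.indicator, h]
  have h2 : ∫ v, (Set.Iio a).indicator 1 ‖v‖ * Φ (‖v‖⁻¹ • v) ∂μ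
      = ∫ q, Φ (q.1 : Vec d) * (Set.Iio a).indicator 1 (q.2 : ℝ)
          ∂μ.toSphere.prod (.volumeIoiPow (d - 1)) := by
    have h3 := μ.measurePreserving_homeomorphUnitSphereProd.integral_comp
      (Homeomorph.measurableEmbedding _)
      (fun q => Φ (q.1 : Vec d) * (Set.Iio a).indicator 1 (q.2 : ℝ))
    rw [finrank_euclideanSpace_fin] at h3
    rw [← h3]
    have h4 := integral_subtype_comap (μ := μ) (measurableSet_singleton (0 : Vec d)).compl
      fun v ↦ (Set.Iio a).indicator 1 ‖v‖ * Φ (‖v‖⁻¹ • v)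
    rw [restrict_compl_singleton] at h4
    rw [← h4]
    refine integral_congr_ae (.of_forall fun v => ?_)
    simp [mul_comm]
  have h5 : ∫ ρ : Set.Ioi (0 : ℝ), (Set.Iio a).indicator 1 (ρ : ℝ) ∂(.volumeIoiPow (d - 1))
      = a ^ d / d := by
    have : (fun ρ : Set.Ioi (0 : ℝ) => (Set.Iio a).indicator (1 : ℝ → ℝ) (ρ : ℝ))
        = (Set.Iio (⟨a, ha⟩ : Set.Ioi (0 : ℝ))).indicator 1 := by
      ext ρ
      by_cases h : (ρ : ℝ) < a
      · rw [Set.indicator_of_mem (by exact h), Set.indicator_of_mem (by exact h)]; rfl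
      · rw [Set.indicator_of_notMem (by exact h), Set.indicator_of_notMem (by exact h)]
    rw [this, integral_indicator_one measurableSet_Iio, Measure.real,
      Measure.volumeIoiPow_apply_Iio, ENNReal.toReal_ofReal (by positivity)]
    have h6 : d - 1 + 1 = d := by omega
    have h7 : ((d - 1 : ℕ) : ℝ) + 1 = d := by exact_mod_cast h6
    rw [h6, h7]
  have h8 : ∫ u : Sph d, Φ u ∂μ.toSphere = d * μ.real (Metric.ball 0 1)
      * ∫ u : Sph d, Φ u ∂uniformSphere d := by
    have h9 := μ.toSphere_real_apply_univ
    rw [finrank_euclideanSpace_fin] at h9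
    rw [uniformSphere, integral_smul_measure, ENNReal.toReal_inv, smul_eq_mul]
    change _ = _ * ((μ.toSphere.real Set.univ)⁻¹ * _)
    rw [h9, mul_inv_cancel_left₀ (mul_pos (by positivity) hV).ne']
  rw [h1, h2, integral_prod_mul (fun u : Sph d => Φ u)
    (fun ρ : Set.Ioi (0 : ℝ) => (Set.Iio a).indicator (1 : ℝ → ℝ) (ρ : ℝ)), h5, h8]
  field_simp
  exact mul_comm _ _

lemma integral_uniformSphere_inner {d : ℕ} (hd : 1 ≤ d) (w : Vec d) :
    ∫ u : Sph d, ⟪(u : Vec d), w⟫ ∂uniformSphere d = 0 := by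
  have h := setIntegral_ball_direction hd (fun v => ⟪v, w⟫) one_pos
  have h2 := setIntegral_ball_direction hd (fun v => ⟪-v, w⟫) one_pos
  have h3 : ∫ v in Metric.ball (0 : Vec d) 1, ⟪-(‖v‖⁻¹ • v), w⟫
      = ∫ v in Metric.ball (0 : Vec d) 1, ⟪‖v‖⁻¹ • v, w⟫ := by
    rw [← integral_indicator measurableSet_ball, ← integral_indicator measurableSet_ball,
      ← integral_neg_eq_self]
    congr 1 with v
    simp [Set.indicator]
  simp only [inner_neg_left, integral_neg] at h2 h3
  have hV := volume_real_ball_pos d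
  have : (1 : ℝ) ^ d * (volume : Measure (Vec d)).real (Metric.ball 0 1)
        * ∫ u : Sph d, ⟪(u : Vec d), w⟫ ∂uniformSphere d = 0 := by linarith
  simpa [hV.ne'] using this

/-! ### A radial bump and its difference quotients -/

/-- The radial bump that is `1` on the ball of radius `a`, vanishes outside the ball of radius
`δ`, and is affine in `‖v‖²` on the annulus in between. -/
noncomputable def ramp {d : ℕ} (a δ : ℝ) (v : Vec d) : ℝ :=
  max 0 (min 1 ((δ ^ 2 - ‖v‖ ^ 2) / (δ ^ 2 - a ^ 2)))

section ramp

variable {d : ℕ} {a δ : ℝ}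

lemma continuous_ramp : Continuous (ramp a δ : Vec d → ℝ) := by
  unfold ramp; fun_prop

lemma ramp_nonneg (v : Vec d) : 0 ≤ ramp a δ v := le_max_left _ _

lemma ramp_le_one (v : Vec d) : ramp a δ v ≤ 1 := by simp [ramp]

lemma ramp_of_le (ha : 0 < a) (haδ : a < δ) {v : Vec d} (hv : ‖v‖ ≤ a) : ramp a δ v = 1 := by
  have h : 0 < δ ^ 2 - a ^ 2 := by nlinarith
  have : 1 ≤ (δ ^ 2 - ‖v‖ ^ 2) / (δ ^ 2 - a ^ 2) := by
    rw [le_div_iff₀ h]; nlinarith [norm_nonneg v]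
  rw [ramp, min_eq_left this]; simp

lemma ramp_of_ge (ha : 0 < a) (haδ : a < δ) {v : Vec d} (hv : δ ≤ ‖v‖) : ramp a δ v = 0 := by
  have h : 0 < δ ^ 2 - a ^ 2 := by nlinarith
  refine max_eq_left ((min_le_right _ _).trans ?_)
  exact div_nonpos_of_nonpos_of_nonneg (by nlinarith) h.le

lemma ramp_of_mem (ha : 0 < a) (haδ : a < δ) {v : Vec d} (h1 : a ≤ ‖v‖) (h2 : ‖v‖ ≤ δ) :
    ramp a δ v = (δ ^ 2 - ‖v‖ ^ 2) / (δ ^ 2 - a ^ 2) := by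
  have h : 0 < δ ^ 2 - a ^ 2 := by nlinarith
  rw [ramp, min_eq_right, max_eq_right]
  · exact div_nonneg (by nlinarith [norm_nonneg v]) h.le
  · rw [div_le_one h]; nlinarith

lemma abs_ramp_sub_ramp_le (ha : 0 < a) (haδ : a < δ) (v v' : Vec d) :
    |ramp a δ v - ramp a δ v'| ≤ |‖v'‖ ^ 2 - ‖v‖ ^ 2| / (δ ^ 2 - a ^ 2) := by
  have h : 0 < δ ^ 2 - a ^ 2 := by nlinarith
  unfold ramp
  calc _ ≤ |min 1 ((δ ^ 2 - ‖v‖ ^ 2) / (δ ^ 2 - a ^ 2))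
        - min 1 ((δ ^ 2 - ‖v'‖ ^ 2) / (δ ^ 2 - a ^ 2))| := by
        simpa only [max_comm] using abs_max_sub_max_le_abs
          (min 1 ((δ ^ 2 - ‖v‖ ^ 2) / (δ ^ 2 - a ^ 2)))
          (min 1 ((δ ^ 2 - ‖v'‖ ^ 2) / (δ ^ 2 - a ^ 2))) 0
    _ ≤ max |(1 : ℝ) - 1| |(δ ^ 2 - ‖v‖ ^ 2) / (δ ^ 2 - a ^ 2)
        - (δ ^ 2 - ‖v'‖ ^ 2) / (δ ^ 2 - a ^ 2)| := abs_min_sub_min_le_max _ _ _ _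
    _ = _ := by
        rw [sub_self, abs_zero, max_eq_right (abs_nonneg _), ← sub_div, abs_div, abs_of_pos h]
        congr 2; ring

lemma hasCompactSupport_ramp (ha : 0 < a) (haδ : a < δ) :
    HasCompactSupport (ramp a δ : Vec d → ℝ) :=
  HasCompactSupport.intro (isCompact_closedBall 0 δ) fun v hv => by
    refine ramp_of_ge ha haδ (le_of_lt ?_)
    simpa using hv

lemma integrable_ramp (ha : 0 < a) (haδ : a < δ) : Integrable (ramp a δ : Vec d → ℝ) :=
  continuous_ramp.integrable_of_hasCompactSupport (hasCompactSupport_ramp ha haδ)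

lemma volume_real_ball_radius {ρ : ℝ} (hρ : 0 < ρ) :
    (volume : Measure (Vec d)).real (Metric.ball 0 ρ)
      = ρ ^ d * (volume : Measure (Vec d)).real (Metric.ball 0 1) := by
  rw [measureReal_def, Measure.addHaar_ball_of_pos _ _ hρ, ENNReal.toReal_mul,
    ENNReal.toReal_ofReal (by positivity), finrank_euclideanSpace_fin, measureReal_def]

lemma volume_real_annulus (ha : 0 < a) (haδ : a < δ) :
    (volume : Measure (Vec d)).real (Metric.ball 0 δ \ Metric.ball 0 a)
      = (δ ^ d - a ^ d) * (volume : Measure (Vec d)).real (Metric.ball 0 1) := by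
  rw [measureReal_sdiff (Metric.ball_subset_ball haδ.le) measurableSet_ball measure_ball_lt_top.ne,
    volume_real_ball_radius (ha.trans haδ), volume_real_ball_radius ha]
  ring

lemma integral_ramp_le (ha : 0 < a) (haδ : a < δ) :
    ∫ v : Vec d, ramp a δ v ≤ δ ^ d * (volume : Measure (Vec d)).real (Metric.ball 0 1) := by
  rw [← volume_real_ball_radius (ha.trans haδ), ← integral_indicator_one measurableSet_ball]
  refine integral_mono (integrable_ramp ha haδ) ?_ fun v => ?_
  · exact (integrable_indicator_iff measurableSet_ball).2
      (integrableOn_const measure_ball_lt_top.ne)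
  · by_cases h : ‖v‖ < δ
    · rw [Set.indicator_of_mem (by simpa using h)]; exact ramp_le_one v
    · rw [ramp_of_ge ha haδ (not_lt.1 h)]
      exact Set.indicator_nonneg (by simp) _

lemma le_integral_ramp (ha : 0 < a) (haδ : a < δ) :
    a ^ d * (volume : Measure (Vec d)).real (Metric.ball 0 1) ≤ ∫ v : Vec d, ramp a δ v := by
  rw [← volume_real_ball_radius ha, ← integral_indicator_one measurableSet_ball]
  refine integral_mono ?_ (integrable_ramp ha haδ) fun v => ?_
  · exact (integrable_indicator_iff measurableSet_ball).2
      (integrableOn_const measure_ball_lt_top.ne)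
  · by_cases h : ‖v‖ < a
    · rw [Set.indicator_of_mem (by simpa using h), ramp_of_le ha haδ h.le]; rfl
    · rw [Set.indicator_of_notMem (by simpa using h)]; exact ramp_nonneg v

/-- Moving the increment from `F` to the weight. -/
lemma integral_mul_ramp_sub_ge (ha : 0 < a) (haδ : a < δ) {F : Vec d → ℝ} (hF : Continuous F)
    (x w : Vec d) {κ s : ℝ} (hs : 0 < s)
    (hκ : ∀ v : Vec d, ‖v‖ ≤ δ → s * κ ≤ F (x + v) - F (x + v - s • w)) :
    κ * ∫ v : Vec d, ramp a δ v
      ≤ ∫ v : Vec d, F (x + v) * ((ramp a δ v - ramp a δ (v + s • w)) / s) := by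
  have hc := hasCompactSupport_ramp (d := d) ha haδ
  have hcont := continuous_ramp (d := d) (a := a) (δ := δ)
  have i1 : Integrable fun v : Vec d => F (x + v) * ramp a δ v :=
    (Continuous.integrable_of_hasCompactSupport (by fun_prop) hc.mul_left)
  have i2 : Integrable fun v : Vec d => F (x + v - s • w) * ramp a δ v :=
    (Continuous.integrable_of_hasCompactSupport (by fun_prop) hc.mul_left)
  have i3 : Integrable fun v : Vec d => F (x + v) * ramp a δ (v + s • w) := by
    have := i2.comp_add_right (s • w)
    refine this.congr (.of_forall fun v => ?_)
    simp only; congr 2; abel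
  have e : ∫ v : Vec d, F (x + v) * ramp a δ (v + s • w)
      = ∫ v : Vec d, F (x + v - s • w) * ramp a δ v := by
    rw [← integral_add_right_eq_self (fun v : Vec d => F (x + v - s • w) * ramp a δ v) (s • w)]
    congr 1 with v; congr 2; abel
  have e2 : ∫ v : Vec d, F (x + v) * ((ramp a δ v - ramp a δ (v + s • w)) / s)
      = s⁻¹ * ∫ v : Vec d, (F (x + v) - F (x + v - s • w)) * ramp a δ v := by
    calc _ = s⁻¹ * ∫ v : Vec d, (F (x + v) * ramp a δ v - F (x + v) * ramp a δ (v + s • w)) := by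
          rw [← integral_const_mul]; congr 1 with v; ring
      _ = _ := by
          rw [integral_sub i1 i3, e, ← integral_sub i1 i2]
          simp only [sub_mul]
  rw [e2, le_inv_mul_iff₀ hs, ← mul_assoc, ← integral_const_mul]
  refine integral_mono ((integrable_ramp ha haδ).const_mul _) ?_ fun v => ?_
  · refine (i1.sub i2).congr (.of_forall fun v => ?_)
    simp [sub_mul]
  · by_cases h : ‖v‖ ≤ δ
    · exact mul_le_mul_of_nonneg_right (hκ v h) (ramp_nonneg v)
    · simp [ramp_of_ge ha haδ (not_le.1 h).le]

/-- The limit of the difference quotients of the ramp only sees the annulus on which the ramp is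
not constant. -/
lemma setIntegral_annulus_ge (ha : 0 < a) (haδ : a < δ) {F : Vec d → ℝ} (hF : Continuous F)
    (x w : Vec d) {κ : ℝ}
    (hκ : ∀ s ∈ Set.Ioc (0 : ℝ) 1, ∀ v : Vec d, ‖v‖ ≤ δ →
      s * κ ≤ F (x + v) - F (x + v - s • w)) :
    κ * ∫ v : Vec d, ramp a δ v
      ≤ 2 / (δ ^ 2 - a ^ 2)
        * ∫ v in Metric.ball (0 : Vec d) δ \ Metric.ball 0 a, F (x + v) * ⟪v, w⟫ := by
  have hpos : 0 < δ ^ 2 - a ^ 2 := by nlinarith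
  have hcont := continuous_ramp (d := d) (a := a) (δ := δ)
  set A : Set (Vec d) := Metric.ball (0 : Vec d) δ \ Metric.ball 0 a with hA
  have hAm : MeasurableSet A := measurableSet_ball.diff measurableSet_ball
  set s : ℕ → ℝ := fun k => 1 / ((k : ℝ) + 1) with hs
  have hs0 : ∀ k, 0 < s k := fun k => by positivity
  have hs1 : ∀ k, s k ≤ 1 := fun k => by
    simp only [hs]; rw [div_le_one (by positivity)]; linarith [Nat.cast_nonneg (α := ℝ) k]
  have hslim : Filter.Tendsto s Filter.atTop (nhds 0) := tendsto_one_div_add_atTop_nhds_zero_nat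
  set B : Vec d → ℝ := (Metric.closedBall 0 (δ + ‖w‖)).indicator
    fun v => |F (x + v)| * ((2 * (δ + ‖w‖) * ‖w‖ + ‖w‖ ^ 2) / (δ ^ 2 - a ^ 2)) with hB
  have key : Filter.Tendsto
      (fun k => ∫ v : Vec d, F (x + v) * ((ramp a δ v - ramp a δ (v + s k • w)) / s k))
      Filter.atTop
      (nhds (∫ v : Vec d, A.indicator
        (fun v => 2 / (δ ^ 2 - a ^ 2) * (F (x + v) * ⟪v, w⟫)) v)) := by
    refine tendsto_integral_of_dominated_convergence B (fun k => ?_) ?_ (fun k => ?_) ?_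
    · exact Continuous.aestronglyMeasurable (by fun_prop)
    · refine (integrable_indicator_iff measurableSet_closedBall).2 ?_
      exact ContinuousOn.integrableOn_compact (isCompact_closedBall _ _) (by fun_prop)
    · refine .of_forall fun v => ?_
      have hsw : ‖s k • w‖ ≤ ‖w‖ := by
        rw [norm_smul, Real.norm_of_nonneg (hs0 k).le]
        exact mul_le_of_le_one_left (norm_nonneg _) (hs1 k)
      by_cases hv : v ∈ Metric.closedBall (0 : Vec d) (δ + ‖w‖)
      · rw [hB, Set.indicator_of_mem hv, Real.norm_eq_abs, abs_mul]
        refine mul_le_mul_of_nonneg_left ?_ (abs_nonneg _)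
        rw [abs_div, abs_of_pos (hs0 k), div_le_iff₀ (hs0 k)]
        refine (abs_ramp_sub_ramp_le ha haδ _ _).trans ?_
        rw [div_mul_eq_mul_div]
        refine div_le_div_of_nonneg_right ?_ hpos.le
        have h1 : ‖v + s k • w‖ ^ 2 - ‖v‖ ^ 2 = s k * (2 * ⟪v, w⟫ + s k * ‖w‖ ^ 2) := by
          rw [norm_add_sq_real, inner_smul_right, norm_smul, Real.norm_of_nonneg (hs0 k).le]
          ring
        rw [h1, abs_mul, abs_of_pos (hs0 k), mul_comm]
        refine mul_le_mul_of_nonneg_right ?_ (hs0 k).le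
        have h2 : |⟪v, w⟫| ≤ (δ + ‖w‖) * ‖w‖ :=
          (abs_real_inner_le_norm v w).trans
            (mul_le_mul_of_nonneg_right (by simpa using hv) (norm_nonneg _))
        have h3 : s k * ‖w‖ ^ 2 ≤ ‖w‖ ^ 2 :=
          mul_le_of_le_one_left (by positivity) (hs1 k)
        have h4 : 0 ≤ s k * ‖w‖ ^ 2 := mul_nonneg (hs0 k).le (by positivity)
        rw [abs_le] at h2 ⊢
        constructor <;> nlinarith
      · have h1 : δ + ‖w‖ < ‖v‖ := by simpa using hv
        have h2 : δ ≤ ‖v + s k • w‖ := by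
          have := norm_sub_norm_le v (-(s k • w))
          rw [norm_neg, sub_neg_eq_add] at this
          linarith
        rw [hB, Set.indicator_of_notMem hv, ramp_of_ge ha haδ h2,
          ramp_of_ge ha haδ (by linarith [norm_nonneg w])]
        simp
    · have hn : ∀ ρ : ℝ, 0 < ρ → ∀ᵐ v : Vec d, ‖v‖ ≠ ρ := fun ρ hρ => by
        have : (volume : Measure (Vec d)) (Metric.sphere 0 ρ) = 0 :=
          Measure.addHaar_sphere_of_ne_zero _ _ hρ.ne'
        refine measure_mono_null (fun v hv => ?_) this
        simpa using hv
      filter_upwards [hn a ha, hn δ (ha.trans haδ)] with v hva hvδ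
      have hlim : Filter.Tendsto (fun k => ‖v + s k • w‖) Filter.atTop (nhds ‖v‖) := by
        have : Filter.Tendsto (fun k => v + s k • w) Filter.atTop (nhds (v + (0 : ℝ) • w)) :=
          (hslim.smul_const w).const_add v
        simpa using this.norm
      rcases lt_or_gt_of_ne hva with h1 | h1
      · have : v ∉ A := by simp [hA, h1]
        rw [Set.indicator_of_notMem this]
        refine tendsto_const_nhds.congr' ?_
        filter_upwards [hlim.eventually (gt_mem_nhds h1)] with k hk
        rw [ramp_of_le ha haδ h1.le, ramp_of_le ha haδ hk.le]
        simp
      rcases lt_or_gt_of_ne hvδ with h2 | h2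
      · have : v ∈ A := by simp [hA, h1.le, h2]
        rw [Set.indicator_of_mem this]
        have h3 : Filter.Tendsto
            (fun k => F (x + v) * ((2 * ⟪v, w⟫ + s k * ‖w‖ ^ 2) / (δ ^ 2 - a ^ 2)))
            Filter.atTop (nhds (F (x + v) * ((2 * ⟪v, w⟫ + 0 * ‖w‖ ^ 2) / (δ ^ 2 - a ^ 2)))) :=
          (((hslim.mul_const _).const_add _).div_const _).const_mul _
        have h4 : F (x + v) * ((2 * ⟪v, w⟫ + 0 * ‖w‖ ^ 2) / (δ ^ 2 - a ^ 2))
            = 2 / (δ ^ 2 - a ^ 2) * (F (x + v) * ⟪v, w⟫) := by ring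
        rw [h4] at h3
        refine h3.congr' ?_
        filter_upwards [hlim.eventually (gt_mem_nhds h2), hlim.eventually (lt_mem_nhds h1)]
          with k hk hk'
        rw [ramp_of_mem ha haδ h1.le h2.le, ramp_of_mem ha haδ hk'.le hk.le,
          norm_add_sq_real, inner_smul_right, norm_smul, Real.norm_of_nonneg (hs0 k).le]
        have := (hs0 k).ne'
        field_simp
        ring
      · have : v ∉ A := by simp [hA, h2.le]
        rw [Set.indicator_of_notMem this]
        refine tendsto_const_nhds.congr' ?_
        filter_upwards [hlim.eventually (lt_mem_nhds h2)] with k hk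
        rw [ramp_of_ge ha haδ h2.le, ramp_of_ge ha haδ hk.le]
        simp
  rw [integral_indicator hAm, integral_const_mul] at key
  exact ge_of_tendsto' key fun k =>
    integral_mul_ramp_sub_ge ha haδ hF x w (hs0 k) (hκ _ ⟨hs0 k, hs1 k⟩)

end ramp

/-! ### The one-point gradient estimator -/

/-- On a thin annulus, `F` may be replaced by its values on the outer sphere. The error carries a
factor `δ - a` in addition to the volume of the annulus. -/
lemma abs_setIntegral_annulus_sub_le {d : ℕ} (hd : 1 ≤ d) {a δ : ℝ} (ha : 0 < a) (haδ : a < δ)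
    {F : Vec d → ℝ} {G : NNReal} (hF : LipschitzWith G F) (x w : Vec d) :
    |(∫ v in Metric.ball (0 : Vec d) δ \ Metric.ball 0 a, F (x + v) * ⟪v, w⟫)
      - δ * ((δ ^ d - a ^ d) * (volume : Measure (Vec d)).real (Metric.ball 0 1)
        * ∫ u : Sph d, F (x + δ • (u : Vec d)) * ⟪(u : Vec d), w⟫ ∂uniformSphere d)|
      ≤ (2 * G * δ + |F x|) * (δ - a) * ‖w‖
        * ((δ ^ d - a ^ d) * (volume : Measure (Vec d)).real (Metric.ball 0 1)) := by
  have hδ := ha.trans haδ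
  set A : Set (Vec d) := Metric.ball (0 : Vec d) δ \ Metric.ball 0 a with hA
  have hAm : MeasurableSet A := measurableSet_ball.diff measurableSet_ball
  have hAfin : volume A ≠ ⊤ := (measure_mono Set.sdiff_subset).trans_lt measure_ball_lt_top |>.ne
  set H : Vec d → ℝ := fun v => F (x + δ • (‖v‖⁻¹ • v)) * ⟪‖v‖⁻¹ • v, w⟫ with hH
  have hdir : Measurable fun v : Vec d => ‖v‖⁻¹ • v := measurable_norm.inv.smul measurable_id
  have hHm : Measurable H :=
    (hF.continuous.measurable.comp ((hdir.const_smul δ).const_add x)).mul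
      (hdir.inner measurable_const)
  have hdirn : ∀ v : Vec d, ‖‖v‖⁻¹ • v‖ ≤ 1 := fun v => by
    rw [norm_smul, norm_inv, norm_norm]; exact inv_mul_le_one
  have hFb : ∀ v : Vec d, ‖v‖ ≤ δ → |F (x + v)| ≤ |F x| + G * δ := fun v hv => by
    have h1 := hF.dist_le_mul (x + v) x
    rw [Real.dist_eq, dist_eq_norm, add_sub_cancel_left] at h1
    have h2 : (G : ℝ) * ‖v‖ ≤ G * δ := mul_le_mul_of_nonneg_left hv G.2
    have h3 := abs_sub_abs_le_abs_sub (F (x + v)) (F x)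
    linarith
  have hδdir : ∀ v : Vec d, ‖δ • (‖v‖⁻¹ • v)‖ ≤ δ := fun v => by
    rw [norm_smul, Real.norm_of_nonneg hδ.le]
    exact mul_le_of_le_one_right hδ.le (hdirn v)
  have hHi : ∀ ρ : ℝ, IntegrableOn H (Metric.ball 0 ρ) := fun ρ => by
    refine Measure.integrableOn_of_bounded (M := (|F x| + G * δ) * ‖w‖)
      measure_ball_lt_top.ne hHm.aestronglyMeasurable (.of_forall fun v => ?_)
    rw [hH, norm_mul, Real.norm_eq_abs, Real.norm_eq_abs]
    refine mul_le_mul (hFb _ (hδdir v)) ?_ (abs_nonneg _) (by positivity)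
    exact (abs_real_inner_le_norm _ _).trans
      (mul_le_of_le_one_left (norm_nonneg _) (hdirn v))
  have hI : (δ ^ d - a ^ d) * (volume : Measure (Vec d)).real (Metric.ball 0 1)
        * ∫ u : Sph d, F (x + δ • (u : Vec d)) * ⟪(u : Vec d), w⟫ ∂uniformSphere d
      = ∫ v in A, H v := by
    rw [setIntegral_sdiff measurableSet_ball (hHi δ) (Metric.ball_subset_ball haδ.le)]
    have h := fun ρ hρ => setIntegral_ball_direction hd
      (fun u : Vec d => F (x + δ • u) * ⟪u, w⟫) (a := ρ) hρ
    simp only [hH]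
    rw [h δ hδ, h a ha]
    ring
  have hFi : IntegrableOn (fun v => F (x + v) * ⟪v, w⟫) A := by
    refine (ContinuousOn.integrableOn_compact (isCompact_closedBall (0 : Vec d) δ) ?_).mono_set
      (Set.sdiff_subset.trans Metric.ball_subset_closedBall)
    have := hF.continuous
    fun_prop
  rw [hI, ← integral_const_mul,
    ← integral_sub hFi (((hHi δ).mono_set Set.sdiff_subset).const_mul δ),
    ← volume_real_annulus ha haδ]
  rw [← Real.norm_eq_abs]
  refine norm_setIntegral_le_of_norm_le_const hAfin.lt_top fun v hv => ?_
  have hv1 : ‖v‖ < δ := by simpa using hv.1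
  have hv2 : a ≤ ‖v‖ := by simpa using hv.2
  have hv0 : 0 < ‖v‖ := ha.trans_le hv2
  set u : Vec d := ‖v‖⁻¹ • v with hu
  have hvu : v = ‖v‖ • u := by rw [hu, smul_smul, mul_inv_cancel₀ hv0.ne', one_smul]
  have hu1 : ‖u‖ ≤ 1 := hdirn v
  have huw : |⟪u, w⟫| ≤ ‖w‖ :=
    (abs_real_inner_le_norm _ _).trans (mul_le_of_le_one_left (norm_nonneg _) hu1)
  have e : F (x + v) * ⟪v, w⟫ - δ * H v
      = (δ * (F (x + v) - F (x + δ • u)) - (δ - ‖v‖) * F (x + v)) * ⟪u, w⟫ := by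
    have : ⟪v, w⟫ = ‖v‖ * ⟪u, w⟫ := by
      conv_lhs => rw [hvu]
      rw [inner_smul_left]; rfl
    rw [this]
    simp only [hH, ← hu]
    ring
  have hd1 : |F (x + v) - F (x + δ • u)| ≤ G * (δ - ‖v‖) := by
    have h1 := hF.dist_le_mul (x + v) (x + δ • u)
    rw [Real.dist_eq, dist_eq_norm, add_sub_add_left_eq_sub] at h1
    refine h1.trans (mul_le_mul_of_nonneg_left ?_ G.2)
    conv_lhs => rw [hvu]
    rw [← sub_smul, norm_smul, Real.norm_eq_abs, abs_sub_comm, abs_of_pos (by linarith)]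
    exact mul_le_of_le_one_right (by linarith) hu1
  rw [e, Real.norm_eq_abs, abs_mul]
  refine mul_le_mul ?_ huw (abs_nonneg _) (mul_nonneg (by positivity) (by linarith))
  refine (abs_sub _ _).trans ?_
  rw [abs_mul, abs_mul, abs_of_pos hδ, abs_of_pos (show 0 < δ - ‖v‖ by linarith)]
  have h1 : δ * |F (x + v) - F (x + δ • u)| ≤ δ * (G * (δ - a)) :=
    mul_le_mul_of_nonneg_left (hd1.trans (mul_le_mul_of_nonneg_left (by linarith) G.2)) hδ.le
  have h2 : (δ - ‖v‖) * |F (x + v)| ≤ (δ - a) * (|F x| + G * δ) :=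
    mul_le_mul (by linarith) (hFb v hv1.le) (abs_nonneg _) (by linarith)
  linarith

/-- The one-point estimator of a convex Lipschitz function is, up to `2 G δ`, a subgradient on
average. -/
theorem sub_le_integral_estimator {d : ℕ} (hd : 1 ≤ d) {𝒦 : Set (Vec d)} {F : Vec d → ℝ}
    {G : NNReal} (hF : LipschitzWith G F) (hconv : ConvexOn ℝ 𝒦 F) {δ : ℝ} (hδ : 0 < δ)
    {x x' : Vec d} (hx : Metric.closedBall x δ ⊆ 𝒦) (hx' : Metric.closedBall x' δ ⊆ 𝒦) :
    F x - F x' - 2 * G * δ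
      ≤ d / δ * ∫ u : Sph d, F (x + δ • (u : Vec d)) * ⟪(u : Vec d), x - x'⟫ ∂uniformSphere d := by
  set κ : ℝ := F x - F x' - 2 * G * δ with hκ
  set w := x - x' with hw
  set I := ∫ u : Sph d, F (x + δ • (u : Vec d)) * ⟪(u : Vec d), w⟫ ∂uniformSphere d
  set V := (volume : Measure (Vec d)).real (Metric.ball 0 1)
  have hV : 0 < V := volume_real_ball_pos d
  have hFd : ∀ y z : Vec d, |F y - F z| ≤ G * ‖y - z‖ := fun y z => by
    simpa [Real.dist_eq, dist_eq_norm] using hF.dist_le_mul y z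
  have hslope : ∀ s ∈ Set.Ioc (0 : ℝ) 1, ∀ v : Vec d, ‖v‖ ≤ δ →
      s * κ ≤ F (x + v) - F (x + v - s • w) := by
    intro s hs v hv
    have h1 : x + v ∈ 𝒦 := hx (by simpa [dist_eq_norm] using hv)
    have h2 : x' + v ∈ 𝒦 := hx' (by simpa [dist_eq_norm] using hv)
    have h3 := hconv.2 h1 h2 (show 0 ≤ 1 - s by linarith [hs.2]) hs.1.le (by ring)
    have h4 : (1 - s) • (x + v) + s • (x' + v) = x + v - s • w := by rw [hw]; module
    rw [h4, smul_eq_mul, smul_eq_mul] at h3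
    -- Chords of a convex function get steeper, and near both ends `F` varies by at most `G δ`.
    have h5 : |F (x + v) - F x| ≤ G * δ := (hFd _ _).trans (by
      rw [add_sub_cancel_left]; exact mul_le_mul_of_nonneg_left hv G.2)
    have h6 : |F (x' + v) - F x'| ≤ G * δ := (hFd _ _).trans (by
      rw [add_sub_cancel_left]; exact mul_le_mul_of_nonneg_left hv G.2)
    rw [abs_le] at h5 h6
    have h7 : κ ≤ F (x + v) - F (x' + v) := by rw [hκ]; linarith
    have := mul_le_mul_of_nonneg_left h7 hs.1.le
    linarith
  -- The geometric sum that cancels the factor `δ - a` from `δ ^ d - a ^ d`.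
  set q : ℝ → ℝ := fun a => ∑ i ∈ Finset.range d, δ ^ i * a ^ (d - 1 - i) with hq
  have hqm : ∀ a, q a * (δ - a) = δ ^ d - a ^ d := fun a =>
    (Commute.all δ a).geom_sum₂_mul d
  have hineq : ∀ a ∈ Set.Ioo 0 δ, κ * δ ^ d - |κ| * (δ ^ d - a ^ d)
      ≤ 2 / (δ + a) * (q a * (δ * I + (2 * G * δ + |F x|) * (δ - a) * ‖w‖)) := by
    intro a ha
    have h1 := setIntegral_annulus_ge ha.1 ha.2 hF.continuous x w hslope
    have h2 := abs_setIntegral_annulus_sub_le hd ha.1 ha.2 hF x w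
    have h3 := le_integral_ramp (d := d) ha.1 ha.2
    have h4 := integral_ramp_le (d := d) ha.1 ha.2
    set J := ∫ v in Metric.ball (0 : Vec d) δ \ Metric.ball 0 a, F (x + v) * ⟪v, w⟫
    set Φ := ∫ v : Vec d, ramp a δ v
    have hda : 0 < δ - a := by linarith [ha.2]
    have hsa : 0 < δ + a := by linarith [ha.1]
    have h5 : V * (κ * δ ^ d - |κ| * (δ ^ d - a ^ d)) ≤ κ * Φ := by
      have h6 : κ * (δ ^ d * V - Φ) ≤ |κ| * ((δ ^ d - a ^ d) * V) :=
        mul_le_mul (le_abs_self κ) (by linarith) (by linarith) (abs_nonneg _)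
      linarith
    have h7 : J ≤ (δ ^ d - a ^ d) * V * (δ * I + (2 * G * δ + |F x|) * (δ - a) * ‖w‖) := by
      linarith [(abs_le.1 h2).2]
    have h8 : 2 / (δ ^ 2 - a ^ 2) * J
        ≤ V * (2 / (δ + a) * (q a * (δ * I + (2 * G * δ + |F x|) * (δ - a) * ‖w‖))) := by
      have h9 : δ ^ 2 - a ^ 2 = (δ - a) * (δ + a) := by ring
      refine (mul_le_mul_of_nonneg_left h7 (by rw [h9]; positivity)).trans_eq ?_
      rw [← hqm, h9]
      field_simp
    exact le_of_mul_le_mul_left (h5.trans (h1.trans h8)) hV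
  have hlim : κ * δ ^ d - |κ| * (δ ^ d - δ ^ d)
      ≤ 2 / (δ + δ) * (q δ * (δ * I + (2 * G * δ + |F x|) * (δ - δ) * ‖w‖)) := by
    have hne : (nhdsWithin δ (Set.Ioo 0 δ)).NeBot := by
      rw [← mem_closure_iff_nhdsWithin_neBot, closure_Ioo hδ.ne]
      exact ⟨hδ.le, le_rfl⟩
    refine le_of_tendsto_of_tendsto (b := nhdsWithin δ (Set.Ioo 0 δ))
      (f := fun a => κ * δ ^ d - |κ| * (δ ^ d - a ^ d))
      (g := fun a => 2 / (δ + a) * (q a * (δ * I + (2 * G * δ + |F x|) * (δ - a) * ‖w‖)))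
      (Filter.Tendsto.mono_left (Continuous.tendsto (by fun_prop) δ) nhdsWithin_le_nhds)
      (Filter.Tendsto.mono_left (ContinuousAt.tendsto ?_) nhdsWithin_le_nhds)
      (Filter.eventually_of_mem self_mem_nhdsWithin hineq)
    refine ContinuousAt.mul (ContinuousAt.div (by fun_prop) (by fun_prop) (by positivity)) ?_
    simp only [hq]
    fun_prop
  have hqδ : q δ = d * δ ^ (d - 1) := geom_sum₂_self δ d
  rw [hqδ, sub_self, sub_self, mul_zero, mul_zero, zero_mul, sub_zero, add_zero] at hlim
  have hpow : δ ^ d = δ ^ (d - 1) * δ := by rw [← pow_succ]; congr 1; omega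
  have hp : 0 < δ ^ (d - 1) := by positivity
  rw [hpow] at hlim
  rw [div_mul_eq_mul_div, le_div_iff₀ hδ]
  refine le_of_mul_le_mul_left (le_trans (le_of_eq ?_) (hlim.trans_eq ?_)) hp
  · ring
  · field_simp; ring

/-- The mean of the estimator has norm at most `d G`, since subtracting the constant `F x` does not
change it. -/
theorem integral_estimator_le {d : ℕ} (hd : 1 ≤ d) {F : Vec d → ℝ}
    {G : NNReal} (hF : LipschitzWith G F) {δ : ℝ} (hδ : 0 < δ) (x w : Vec d) :
    d / δ * ∫ u : Sph d, F (x + δ • (u : Vec d)) * ⟪(u : Vec d), w⟫ ∂uniformSphere d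
      ≤ d * G * ‖w‖ := by
  have := isProbabilityMeasure_uniformSphere hd
  have hFc := hF.continuous
  have hu : ∀ u : Sph d, ‖(u : Vec d)‖ = 1 := fun u => by simp
  have huw : ∀ u : Sph d, |⟪(u : Vec d), w⟫| ≤ ‖w‖ := fun u => by
    simpa [hu u] using abs_real_inner_le_norm (u : Vec d) w
  have h1 : ∀ u : Sph d, |(F (x + δ • (u : Vec d)) - F x) * ⟪(u : Vec d), w⟫| ≤ G * δ * ‖w‖ := by
    intro u
    rw [abs_mul]
    refine mul_le_mul ?_ (huw u) (abs_nonneg _) (by positivity)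
    have := hF.dist_le_mul (x + δ • (u : Vec d)) x
    rwa [Real.dist_eq, dist_eq_norm, add_sub_cancel_left, norm_smul, hu, mul_one,
      Real.norm_of_nonneg hδ.le] at this
  have i1 : Integrable (fun u : Sph d => F (x + δ • (u : Vec d)) * ⟪(u : Vec d), w⟫)
      (uniformSphere d) :=
    Continuous.integrable_of_hasCompactSupport (by fun_prop) (.of_compactSpace _)
  have i2 : Integrable (fun u : Sph d => F x * ⟪(u : Vec d), w⟫) (uniformSphere d) :=
    Continuous.integrable_of_hasCompactSupport (by fun_prop) (.of_compactSpace _)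
  have h2 : ∫ u : Sph d, F (x + δ • (u : Vec d)) * ⟪(u : Vec d), w⟫ ∂uniformSphere d
      = ∫ u : Sph d, (F (x + δ • (u : Vec d)) - F x) * ⟪(u : Vec d), w⟫ ∂uniformSphere d := by
    simp only [sub_mul]
    rw [integral_sub i1 i2, integral_const_mul, integral_uniformSphere_inner hd]
    simp
  have h3 : ∫ u : Sph d, (F (x + δ • (u : Vec d)) - F x) * ⟪(u : Vec d), w⟫ ∂uniformSphere d
      ≤ G * δ * ‖w‖ := by
    refine (le_abs_self _).trans ?_
    simpa using norm_integral_le_of_norm_le_const (μ := uniformSphere d)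
      (.of_forall fun u => (Real.norm_eq_abs _).trans_le (h1 u))
  rw [h2, div_mul_eq_mul_div, div_le_iff₀ hδ]
  calc _ ≤ (d : ℝ) * (G * δ * ‖w‖) := mul_le_mul_of_nonneg_left h3 (by positivity)
    _ = _ := by ring

/-! ### Mixing over the network -/

section network

variable {d n : ℕ} {E : Fin n → Fin n → Prop} {P : Matrix (Fin n) (Fin n) ℝ}

lemma sigma2_nonneg (P : Matrix (Fin n) (Fin n) ℝ) : 0 ≤ sigma2 P :=
  LinearMap.singularValues_nonneg _ _

/-- On the orthogonal complement of the constant vectors, `P` has norm at most `σ₂(P)`: since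
`σ₂(P) < 1`, the constant vectors span the eigenspace of the top eigenvalue of `Pᵀ P`. -/
lemma norm_toEuclideanLin_le_sigma2 (hP : IsWeightMatrix E P) (v : EuclideanSpace ℝ (Fin n))
    (hv : ∑ i, v i = 0) : ‖Matrix.toEuclideanLin P v‖ ≤ sigma2 P * ‖v‖ := by
  set A := Matrix.toEuclideanLin P with hA
  have hn : Module.finrank ℝ (EuclideanSpace ℝ (Fin n)) = n := by simp
  set S := A.adjoint ∘ₗ A with hS
  have hsymm : S.IsSymmetric := A.isSymmetric_adjoint_comp_self
  set b := hsymm.eigenvectorBasis hn with hb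
  set lam := hsymm.eigenvalues hn with hlam
  have hsv : ∀ k : Fin n, lam k = A.singularValues k ^ 2 := fun k =>
    (A.sq_singularValues_fin hn k).symm
  have hSb : ∀ k (u : EuclideanSpace ℝ (Fin n)), ⟪b k, S u⟫ = lam k * ⟪b k, u⟫ := fun k u => by
    rw [← hsymm, hb, hsymm.apply_eigenvectorBasis]
    rw [inner_smul_left]; rfl
  -- Eigenvalues are numbered in decreasing order, so `σ₂(P)²` bounds all but the first.
  have hle : ∀ k : Fin n, (k : ℕ) ≠ 0 → lam k ≤ sigma2 P ^ 2 := fun k hk => by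
    rw [hsv]
    exact pow_le_pow_left₀ (A.singularValues_nonneg _)
      (A.singularValues_antitone (Nat.one_le_iff_ne_zero.2 hk)) 2
  have hσ0 := sigma2_nonneg P
  have hlt : ∀ k : Fin n, (k : ℕ) ≠ 0 → lam k < 1 := fun k hk =>
    (hle k hk).trans_lt (by have := hP.gap; nlinarith)
  set e : EuclideanSpace ℝ (Fin n) := WithLp.toLp 2 1 with he
  have hAe : A e = e := by
    rw [hA, he, Matrix.toLpLin_toLp, Matrix.toLin'_apply, (mem_doublyStochastic.1 hP.stochastic).2.1]
  have hSe : S e = e := by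
    have h1 : A.adjoint = A := by
      rw [hA, ← Matrix.toEuclideanLin_conjTranspose_eq_adjoint]
      congr 1
      rw [Matrix.conjTranspose_eq_transpose_of_trivial]; exact hP.symm
    rw [hS, LinearMap.comp_apply, h1, hAe, hAe]
  have hbe : ∀ k : Fin n, (k : ℕ) ≠ 0 → ⟪b k, e⟫ = 0 := fun k hk => by
    have h1 := hSb k e
    rw [hSe] at h1
    have h2 := hlt k hk
    have h3 : (1 - lam k) * ⟪b k, e⟫ = 0 := by linarith
    exact (mul_eq_zero.1 h3).resolve_left (by linarith)
  have hev : ⟪e, v⟫ = 0 := by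
    rw [PiLp.inner_apply]; simpa [he] using hv
  have hterm : ∀ k : Fin n, lam k * ⟪b k, v⟫ ^ 2 ≤ sigma2 P ^ 2 * ⟪b k, v⟫ ^ 2 := by
    intro k
    by_cases hk : (k : ℕ) = 0
    · have h1 : ⟪b k, e⟫ * ⟪b k, v⟫ = 0 := by
        rw [← hev, ← b.sum_inner_mul_inner e v,
          Finset.sum_eq_single k]
        · rw [real_inner_comm]
        · intro j _ hj
          rw [real_inner_comm, hbe j (fun h => hj (Fin.ext (h.trans hk.symm))), zero_mul]
        · simp
      have h2 : ⟪b k, e⟫ ≠ 0 := by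
        intro h0
        have : e = 0 := by
          rw [← b.sum_repr' e]
          refine Finset.sum_eq_zero fun j _ => ?_
          by_cases hj : (j : ℕ) = 0
          · rw [show j = k from Fin.ext (hj.trans hk.symm), h0, zero_smul]
          · rw [hbe j hj, zero_smul]
        have h3 := congrArg (fun u : EuclideanSpace ℝ (Fin n) => u k) this
        simp [he] at h3
      rw [(mul_eq_zero.1 h1).resolve_left h2]; simp
    · exact mul_le_mul_of_nonneg_right (hle k hk) (sq_nonneg _)
  have h1 : ‖A v‖ ^ 2 = ∑ k, lam k * ⟪b k, v⟫ ^ 2 := by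
    have h2 : ‖A v‖ ^ 2 = ⟪v, S v⟫ := by
      rw [hS, LinearMap.comp_apply, LinearMap.adjoint_inner_right, real_inner_self_eq_norm_sq]
    rw [h2, ← b.sum_inner_mul_inner v (S v)]
    refine Finset.sum_congr rfl fun k _ => ?_
    rw [hSb, real_inner_comm]; ring
  have h2 : ‖v‖ ^ 2 = ∑ k, ⟪b k, v⟫ ^ 2 := by
    rw [← real_inner_self_eq_norm_sq, ← b.sum_inner_mul_inner v v]
    refine Finset.sum_congr rfl fun k _ => ?_
    rw [real_inner_comm]; ring
  refine le_of_sq_le_sq ?_ (by positivity)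
  rw [mul_pow, h1, h2, Finset.mul_sum]
  exact Finset.sum_le_sum fun k _ => hterm k

lemma sum_norm_sq_mix_le (hP : IsWeightMatrix E P) (W : Fin n → Vec d) (hW : ∑ i, W i = 0) :
    ∑ i, ‖∑ j, P i j • W j‖ ^ 2 ≤ sigma2 P ^ 2 * ∑ i, ‖W i‖ ^ 2 := by
  have h : ∀ k : Fin d, ∑ i, (∑ j, P i j * W j k) ^ 2 ≤ sigma2 P ^ 2 * ∑ i, W i k ^ 2 := by
    intro k
    have h1 := norm_toEuclideanLin_le_sigma2 hP (WithLp.toLp 2 fun i => W i k) (by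
      have := congrArg (fun u : Vec d => u k) hW
      simpa using this)
    have h2 := pow_le_pow_left₀ (norm_nonneg _) h1 2
    rw [mul_pow, EuclideanSpace.real_norm_sq_eq, EuclideanSpace.real_norm_sq_eq] at h2
    simpa [Matrix.mulVec, dotProduct] using h2
  simp only [EuclideanSpace.real_norm_sq_eq]
  rw [Finset.sum_comm, Finset.sum_comm (f := fun i k => W i k ^ 2), Finset.mul_sum]
  refine Finset.sum_le_sum fun k _ => ?_
  simpa using h k

/-- The average of the vectors held by the learners. -/
noncomputable def avg (W : Fin n → Vec d) : Vec d := (n : ℝ)⁻¹ • ∑ i, W i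

/-- The Euclidean norm of the stacked vector of all `n` vectors. -/
noncomputable def stackNorm (W : Fin n → Vec d) : ℝ := √(∑ i, ‖W i‖ ^ 2)

lemma stackNorm_eq (W : Fin n → Vec d) :
    stackNorm W = ‖(WithLp.toLp 2 W : PiLp 2 fun _ : Fin n => Vec d)‖ := by
  rw [PiLp.norm_eq_of_L2]; rfl

lemma stackNorm_nonneg (W : Fin n → Vec d) : 0 ≤ stackNorm W := Real.sqrt_nonneg _

lemma stackNorm_sq (W : Fin n → Vec d) : stackNorm W ^ 2 = ∑ i, ‖W i‖ ^ 2 :=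
  Real.sq_sqrt (by positivity)

lemma stackNorm_add_le (W W' : Fin n → Vec d) :
    stackNorm (fun i => W i + W' i) ≤ stackNorm W + stackNorm W' := by
  simp only [stackNorm_eq]
  exact norm_add_le (WithLp.toLp 2 W : PiLp 2 fun _ : Fin n => Vec d) (WithLp.toLp 2 W')

lemma norm_le_stackNorm (W : Fin n → Vec d) (i : Fin n) : ‖W i‖ ≤ stackNorm W :=
  Real.le_sqrt_of_sq_le
    (Finset.single_le_sum (f := fun i => ‖W i‖ ^ 2) (fun _ _ => sq_nonneg _) (Finset.mem_univ i))

lemma sum_eq_smul_avg (hn : n ≠ 0) (W : Fin n → Vec d) : ∑ i, W i = (n : ℝ) • avg W := by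
  rw [avg, smul_inv_smul₀ (by exact_mod_cast hn)]

lemma avg_add (W W' : Fin n → Vec d) : avg (fun i => W i + W' i) = avg W + avg W' := by
  simp [avg, Finset.sum_add_distrib]

lemma avg_mix (hP : IsWeightMatrix E P) (W : Fin n → Vec d) :
    avg (fun i => ∑ j, P i j • W j) = avg W := by
  rw [avg, avg, Finset.sum_comm]
  congr 1
  refine Finset.sum_congr rfl fun j _ => ?_
  rw [← Finset.sum_smul, sum_col_of_mem_doublyStochastic hP.stochastic j, one_smul]

lemma sum_norm_sub_avg_sq (hn : n ≠ 0) (W : Fin n → Vec d) :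
    ∑ i, ‖W i - avg W‖ ^ 2 = ∑ i, ‖W i‖ ^ 2 - n * ‖avg W‖ ^ 2 := by
  simp only [norm_sub_sq_real]
  rw [Finset.sum_add_distrib, Finset.sum_sub_distrib, ← Finset.mul_sum, ← sum_inner,
    sum_eq_smul_avg hn, inner_smul_left, real_inner_self_eq_norm_sq]
  simp only [Finset.sum_const, Finset.card_univ, Fintype.card_fin, nsmul_eq_mul, conj_trivial]
  ring

lemma norm_avg_sq_le (hn : n ≠ 0) (W : Fin n → Vec d) :
    n * ‖avg W‖ ^ 2 ≤ ∑ i, ‖W i‖ ^ 2 := by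
  have h := sum_norm_sub_avg_sq hn W
  have : 0 ≤ ∑ i, ‖W i - avg W‖ ^ 2 := by positivity
  linarith

lemma stackNorm_sub_avg_le (hn : n ≠ 0) (W : Fin n → Vec d) :
    stackNorm (fun i => W i - avg W) ≤ stackNorm W := by
  refine Real.sqrt_le_sqrt ?_
  rw [sum_norm_sub_avg_sq hn]
  have : 0 ≤ n * ‖avg W‖ ^ 2 := by positivity
  linarith

/-- One round of mixing contracts the disagreement of the learners by `σ₂(P)`. -/
lemma stackNorm_mix_add_sub_avg_le (hn : n ≠ 0) (hP : IsWeightMatrix E P)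
    (W g : Fin n → Vec d) :
    stackNorm (fun i => (∑ j, P i j • W j + g i) - avg (fun i => ∑ j, P i j • W j + g i))
      ≤ sigma2 P * stackNorm (fun i => W i - avg W) + stackNorm g := by
  have h0 : ∑ i, (W i - avg W) = 0 := by
    rw [Finset.sum_sub_distrib, sum_eq_smul_avg hn]
    simp [← Nat.cast_smul_eq_nsmul ℝ]
  have h1 : ∀ i, ∑ j, P i j • W j - avg W = ∑ j, P i j • (W j - avg W) := fun i => by
    simp only [smul_sub, Finset.sum_sub_distrib, ← Finset.sum_smul]
    rw [sum_row_of_mem_doublyStochastic hP.stochastic i, one_smul]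
  have h2 : (fun i => (∑ j, P i j • W j + g i) - avg (fun i => ∑ j, P i j • W j + g i))
      = fun i => (∑ j, P i j • (W j - avg W)) + (g i - avg g) := by
    ext1 i
    rw [avg_add (fun i => ∑ j, P i j • W j) g, avg_mix hP, ← h1]; abel
  rw [h2]
  refine (stackNorm_add_le _ _).trans (add_le_add ?_ (stackNorm_sub_avg_le hn g))
  rw [stackNorm, stackNorm]
  refine Real.sqrt_le_iff.2 ⟨mul_nonneg (sigma2_nonneg P) (Real.sqrt_nonneg _), ?_⟩
  rw [mul_pow, Real.sq_sqrt (by positivity)]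
  exact sum_norm_sq_mix_le hP _ h0

end network

/-! ### Conditional gradient and the regularized leader -/

section regularized

variable {d : ℕ} {S : Set (Vec d)} {h : ℝ} {x₀ : Vec d}

/-- The regularized linear objective `⟪z, x⟫ + h ‖x - x₀‖²`, which is the surrogate loss of
D-BBCG when `α = 0`. -/
noncomputable def regLoss (h : ℝ) (x₀ z x : Vec d) : ℝ := ⟪z, x⟫ + h * ‖x - x₀‖ ^ 2

lemma continuous_regLoss (z : Vec d) : Continuous (regLoss h x₀ z) := by
  unfold regLoss; fun_prop

lemma regLoss_line (z c v : Vec d) (a : ℝ) :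
    regLoss h x₀ z (c + a • (v - c)) = regLoss h x₀ z c
      + a * ⟪z + (2 * h) • (c - x₀), v - c⟫ + h * a ^ 2 * ‖v - c‖ ^ 2 := by
  have h1 : c + a • (v - c) - x₀ = (c - x₀) + a • (v - c) := by abel
  simp only [regLoss]
  rw [h1, norm_add_sq_real, inner_add_right, inner_smul_right, inner_smul_right, norm_smul,
    inner_add_left, inner_smul_left, mul_pow, Real.norm_eq_abs, sq_abs]
  simp only [conj_trivial]
  ring

lemma gradient_regLoss (z c : Vec d) :
    ∇ (regLoss h x₀ z) c = z + (2 * h) • (c - x₀) := by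
  refine HasGradientAt.gradient ?_
  rw [hasGradientAt_iff_hasFDerivAt]
  have h1 : HasFDerivAt (fun x : Vec d => ⟪z, x⟫) (innerSL ℝ z) c := (innerSL ℝ z).hasFDerivAt
  have h2 : HasFDerivAt (fun x : Vec d => ‖x - x₀‖ ^ 2) (2 • innerSL ℝ (c - x₀)) c := by
    simpa using ((hasFDerivAt_id c).sub_const x₀).norm_sq
  refine (h1.add (h2.const_mul h)).congr_fderiv ?_
  ext y
  simp
  ring

/-- `y` minimizes `regLoss h x₀ z` over `S`, with quadratic growth. -/
def IsRegMin (S : Set (Vec d)) (h : ℝ) (x₀ z y : Vec d) : Prop :=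
  y ∈ S ∧ ∀ x ∈ S, regLoss h x₀ z y + h * ‖x - y‖ ^ 2 ≤ regLoss h x₀ z x

lemma exists_isRegMin (hS : IsCompact S) (hconv : Convex ℝ S) (hne : S.Nonempty)
    (z : Vec d) : ∃ y, IsRegMin S h x₀ z y := by
  obtain ⟨y, hy, hmin⟩ :=
    hS.exists_isMinOn hne (continuous_regLoss (h := h) (x₀ := x₀) z).continuousOn
  refine ⟨y, hy, fun x hx => ?_⟩
  set D := ⟪z + (2 * h) • (y - x₀), x - y⟫ with hD
  have hstep : ∀ a ∈ Set.Ioc (0 : ℝ) 1, 0 ≤ D + h * a * ‖x - y‖ ^ 2 := fun a ha => by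
    have h1 : y + a • (x - y) ∈ S := hconv.add_smul_sub_mem hy hx ⟨ha.1.le, ha.2⟩
    have h2 : regLoss h x₀ z y ≤ regLoss h x₀ z (y + a • (x - y)) := hmin h1
    rw [regLoss_line] at h2
    have h3 : 0 ≤ a * (D + h * a * ‖x - y‖ ^ 2) := by linarith
    exact nonneg_of_mul_nonneg_right h3 ha.1
  have hD0 : 0 ≤ D := by
    have hlim : Filter.Tendsto (fun a : ℝ => D + h * a * ‖x - y‖ ^ 2)
        (nhdsWithin 0 (Set.Ioc 0 1)) (nhds (D + h * 0 * ‖x - y‖ ^ 2)) :=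
      Filter.Tendsto.mono_left (Continuous.tendsto (by fun_prop) 0) nhdsWithin_le_nhds
    have hne : (nhdsWithin (0 : ℝ) (Set.Ioc 0 1)).NeBot := by
      rw [← mem_closure_iff_nhdsWithin_neBot, closure_Ioc zero_ne_one]
      exact ⟨le_rfl, zero_le_one⟩
    have := ge_of_tendsto hlim (Filter.eventually_of_mem self_mem_nhdsWithin hstep)
    simpa using this
  have h4 := regLoss_line (h := h) (x₀ := x₀) z y x 1
  rw [one_smul, add_sub_cancel] at h4
  rw [h4]
  linarith

/-- The minimizer of the regularized linear objective over `S`, with a junk value if there is none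
(there is one if `S` is compact, convex and nonempty). -/
noncomputable def regMin (S : Set (Vec d)) (h : ℝ) (x₀ z : Vec d) : Vec d :=
  Classical.epsilon (IsRegMin S h x₀ z)

lemma isRegMin_regMin (hS : IsCompact S) (hconv : Convex ℝ S) (hne : S.Nonempty)
    (z : Vec d) : IsRegMin S h x₀ z (regMin S h x₀ z) :=
  Classical.epsilon_spec (exists_isRegMin hS hconv hne z)

/-- By strong convexity the minimizer is a Lipschitz function of the linear part. -/
lemma IsRegMin.norm_sub_le (h0 : 0 < h) {z z' y y' : Vec d} (hy : IsRegMin S h x₀ z y)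
    (hy' : IsRegMin S h x₀ z' y') : ‖y - y'‖ ≤ ‖z - z'‖ / (2 * h) := by
  have h1 := hy.2 _ hy'.1
  have h2 := hy'.2 _ hy.1
  have h3 := real_inner_le_norm (z - z') (y' - y)
  simp only [regLoss] at h1 h2
  rw [norm_sub_rev y' y, inner_sub_left, inner_sub_right, inner_sub_right] at h3
  rw [norm_sub_rev y' y] at h1
  rw [le_div_iff₀ (by positivity)]
  rcases (norm_nonneg (y - y')).eq_or_lt with h4 | h4
  · rw [← h4]; simp
  · refine le_of_mul_le_mul_right ?_ h4
    linarith

lemma IsRegMin.eq_start (h0 : 0 < h) (hx₀ : x₀ ∈ S) {y : Vec d} (hy : IsRegMin S h x₀ 0 y) :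
    y = x₀ := by
  have h1 := hy.2 _ hx₀
  simp only [regLoss, inner_zero_left, sub_self, norm_zero] at h1
  rw [norm_sub_rev x₀ y] at h1
  have h2 : ‖y - x₀‖ ^ 2 ≤ 0 := by nlinarith
  have h3 : ‖y - x₀‖ = 0 := by nlinarith [norm_nonneg (y - x₀)]
  exact sub_eq_zero.1 (norm_eq_zero.1 h3)

/-- Regret of follow-the-regularized-leader on linear losses `g 1, g 2, …` -/
lemma sum_inner_regMin_le (hS : IsCompact S) (hconv : Convex ℝ S) (h0 : 0 < h) (hx₀ : x₀ ∈ S)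
    (z g : ℕ → Vec d) (B : ℕ) (hz1 : z 1 = 0)
    (hz : ∀ m ∈ Finset.Icc 1 B, z (m + 1) = z m + g m) {x : Vec d} (hx : x ∈ S) :
    ∑ m ∈ Finset.Icc 1 B, ⟪g m, regMin S h x₀ (z m) - x⟫
      ≤ h * ‖x - x₀‖ ^ 2 + ∑ m ∈ Finset.Icc 1 B, ‖g m‖ ^ 2 / (4 * h) := by
  have hmin := fun z => isRegMin_regMin (h := h) (x₀ := x₀) hS hconv ⟨x, hx⟩ z
  set y := fun m => regMin S h x₀ (z m) with hy
  -- The minimal value of the regularized objective serves as potential.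
  have key : ∀ b ≤ B, ∑ m ∈ Finset.Icc 1 b, ⟪g m, y m⟫
      ≤ regLoss h x₀ (z (b + 1)) (y (b + 1)) + ∑ m ∈ Finset.Icc 1 b, ‖g m‖ ^ 2 / (4 * h)
        ∧ z (b + 1) = ∑ m ∈ Finset.Icc 1 b, g m := by
    intro b hb
    induction b with
    | zero =>
      simp [hy, hz1, (hmin 0).eq_start h0 hx₀, regLoss]
    | succ b ih =>
      obtain ⟨ih1, ih2⟩ := ih (by omega)
      have hzb := hz (b + 1) (Finset.mem_Icc.2 ⟨by omega, hb⟩)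
      refine ⟨?_, by rw [Finset.sum_Icc_succ_top (by omega), ← ih2, hzb]⟩
      rw [Finset.sum_Icc_succ_top (by omega), Finset.sum_Icc_succ_top (by omega)]
      have h1 := (hmin (z (b + 1))).2 _ (hmin (z (b + 1 + 1))).1
      change regLoss h x₀ (z (b + 1)) (y (b + 1)) + h * ‖y (b + 1 + 1) - y (b + 1)‖ ^ 2
        ≤ regLoss h x₀ (z (b + 1)) (y (b + 1 + 1)) at h1
      have h2 : regLoss h x₀ (z (b + 1 + 1)) (y (b + 1 + 1))
          = regLoss h x₀ (z (b + 1)) (y (b + 1 + 1)) + ⟪g (b + 1), y (b + 1 + 1)⟫ := by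
        simp only [regLoss]; rw [hzb, inner_add_left]; ring
      have h3 : ⟪g (b + 1), y (b + 1)⟫ - ⟪g (b + 1), y (b + 1 + 1)⟫
          ≤ ‖g (b + 1)‖ * ‖y (b + 1 + 1) - y (b + 1)‖ := by
        rw [← inner_sub_right, norm_sub_rev]; exact real_inner_le_norm _ _
      have h4 : ‖g (b + 1)‖ * ‖y (b + 1 + 1) - y (b + 1)‖
          ≤ h * ‖y (b + 1 + 1) - y (b + 1)‖ ^ 2 + ‖g (b + 1)‖ ^ 2 / (4 * h) := by
        have : 0 ≤ (2 * h * ‖y (b + 1 + 1) - y (b + 1)‖ - ‖g (b + 1)‖) ^ 2 / (4 * h) := by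
          positivity
        have e : (2 * h * ‖y (b + 1 + 1) - y (b + 1)‖ - ‖g (b + 1)‖) ^ 2 / (4 * h)
            = h * ‖y (b + 1 + 1) - y (b + 1)‖ ^ 2 + ‖g (b + 1)‖ ^ 2 / (4 * h)
              - ‖g (b + 1)‖ * ‖y (b + 1 + 1) - y (b + 1)‖ := by
          field_simp; ring
        linarith
      linarith
  obtain ⟨k1, k2⟩ := key B le_rfl
  have h5 := (hmin (z (B + 1))).2 x hx
  have h6 : regLoss h x₀ (z (B + 1)) x
      = ∑ m ∈ Finset.Icc 1 B, ⟪g m, x⟫ + h * ‖x - x₀‖ ^ 2 := by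
    rw [regLoss, k2, sum_inner]
  have h7 : 0 ≤ h * ‖x - y (B + 1)‖ ^ 2 := by positivity
  simp only [inner_sub_right, Finset.sum_sub_distrib]
  change _ ≤ regLoss h x₀ (z (B + 1)) x at h5
  change regLoss h x₀ (z (B + 1)) (y (B + 1)) + h * ‖x - y (B + 1)‖ ^ 2 ≤ _ at h5
  linarith

lemma IsCGRun.mem {L : ℕ} {F : Vec d → ℝ} {x₁ : Vec d} {c v : ℕ → Vec d} {s : ℕ → ℝ}
    (hrun : IsCGRun S L F x₁ c v s) (hconv : Convex ℝ S) (hx₁ : x₁ ∈ S) :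
    ∀ τ ≤ L, c τ ∈ S := by
  intro τ hτ
  induction τ with
  | zero => rw [hrun.init]; exact hx₁
  | succ τ ih =>
    rw [hrun.step τ hτ]
    exact hconv.add_smul_sub_mem (ih (by omega)) (hrun.vertex_mem τ hτ) (hrun.search_mem τ hτ)

/-- Convergence of conditional gradient with line search on the regularized objective: the gap
after `τ ≥ 1` steps is at most `4 h (2 R)² / (τ + 2)`, whatever the starting point. -/
lemma IsCGRun.norm_sub_sq_le {L : ℕ} {R : ℝ} {z x₁ y : Vec d} {c v : ℕ → Vec d} {s : ℕ → ℝ}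
    (hrun : IsCGRun S L (regLoss h x₀ z) x₁ c v s) (hconv : Convex ℝ S) (h0 : 0 < h)
    (hR : S ⊆ Metric.closedBall 0 R) (hx₁ : x₁ ∈ S) (hy : IsRegMin S h x₀ z y) (hL : 1 ≤ L) :
    ‖c L - y‖ ^ 2 ≤ (4 * R) ^ 2 / L := by
  have hmem := hrun.mem hconv hx₁
  have hdiam : ∀ a ∈ S, ∀ b ∈ S, ‖a - b‖ ^ 2 ≤ (2 * R) ^ 2 := fun a ha b hb => by
    have h1 : ‖a‖ ≤ R := by simpa using hR ha
    have h2 : ‖b‖ ≤ R := by simpa using hR hb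
    exact pow_le_pow_left₀ (norm_nonneg _) ((norm_sub_le a b).trans (by linarith)) 2
  set gap := fun τ => regLoss h x₀ z (c τ) - regLoss h x₀ z y with hgap
  set D := h * (2 * R) ^ 2 with hD
  have hD0 : 0 ≤ D := by positivity
  have hstep : ∀ τ < L, ∀ a ∈ Set.Icc (0 : ℝ) 1,
      gap (τ + 1) ≤ (1 - a) * gap τ + a ^ 2 * D := by
    intro τ hτ a ha
    have h1 : regLoss h x₀ z (c (τ + 1)) ≤ regLoss h x₀ z (c τ + a • (v τ - c τ)) := by
      rw [hrun.step τ hτ]; exact hrun.search_min τ hτ ha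
    rw [regLoss_line] at h1
    have h2 : ⟪z + (2 * h) • (c τ - x₀), v τ⟫ ≤ ⟪z + (2 * h) • (c τ - x₀), y⟫ := by
      have := hrun.vertex_min τ hτ hy.1
      rwa [gradient_regLoss] at this
    have h3 := regLoss_line (h := h) (x₀ := x₀) z (c τ) y 1
    rw [one_smul, add_sub_cancel] at h3
    have h4 : 0 ≤ h * ‖y - c τ‖ ^ 2 := by positivity
    rw [inner_sub_right] at h1 h3
    have h5 : a * ⟪z + (2 * h) • (c τ - x₀), v τ⟫ ≤ a * ⟪z + (2 * h) • (c τ - x₀), y⟫ :=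
      mul_le_mul_of_nonneg_left h2 ha.1
    have h6 : h * a ^ 2 * ‖v τ - c τ‖ ^ 2 ≤ h * a ^ 2 * (2 * R) ^ 2 :=
      mul_le_mul_of_nonneg_left (hdiam _ (hrun.vertex_mem τ hτ) _ (hmem τ hτ.le)) (by positivity)
    have h7 : a * (⟪z + (2 * h) • (c τ - x₀), y⟫ - ⟪z + (2 * h) • (c τ - x₀), c τ⟫)
        ≤ a * (-gap τ) := by
      refine mul_le_mul_of_nonneg_left ?_ ha.1
      simp only [hgap]; linarith
    simp only [hgap, hD] at *
    linarith
  have hrate : ∀ τ, τ + 1 ≤ L → gap (τ + 1) ≤ 4 * D / (τ + 3) := by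
    intro τ hτ
    induction τ with
    | zero =>
      -- The full step `a = 1` forgets the initial gap.
      have := hstep 0 hτ 1 ⟨zero_le_one, le_rfl⟩
      rw [le_div_iff₀ (by positivity)]
      push_cast
      linarith
    | succ τ ih =>
      have h1 := ih (by omega)
      have h2 : (0 : ℝ) < τ + 3 := by positivity
      have h3 := hstep (τ + 1) hτ (2 / (τ + 3)) ⟨by positivity, by
        rw [div_le_one h2]; linarith [Nat.cast_nonneg (α := ℝ) τ]⟩
      have h4 : (1 - 2 / ((τ : ℝ) + 3)) * gap (τ + 1)
          ≤ (1 - 2 / ((τ : ℝ) + 3)) * (4 * D / (τ + 3)) := by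
        refine mul_le_mul_of_nonneg_left h1 ?_
        rw [sub_nonneg, div_le_one h2]; linarith [Nat.cast_nonneg (α := ℝ) τ]
      refine h3.trans ((add_le_add_left h4 _).trans ?_)
      have e : (1 - 2 / ((τ : ℝ) + 3)) * (4 * D / (τ + 3)) + (2 / ((τ : ℝ) + 3)) ^ 2 * D
          = 4 * D * ((τ + 2) / (τ + 3) ^ 2) := by field_simp; ring
      have h5 : ((τ : ℝ) + 2) / (τ + 3) ^ 2 ≤ 1 / (τ + 4) := by
        rw [div_le_div_iff₀ (by positivity) (by positivity)]
        nlinarith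
      rw [e]
      push_cast
      calc _ ≤ 4 * D * (1 / ((τ : ℝ) + 4)) := mul_le_mul_of_nonneg_left h5 (by positivity)
        _ = _ := by ring
  obtain ⟨τ, rfl⟩ : ∃ τ, L = τ + 1 := ⟨L - 1, by omega⟩
  have h1 := hrate τ le_rfl
  have h2 := hy.2 _ (hmem (τ + 1) le_rfl)
  have h3 : h * ‖c (τ + 1) - y‖ ^ 2 ≤ 4 * D / (τ + 3) := by
    simp only [hgap] at h1; linarith
  have h4 : 4 * D / ((τ : ℝ) + 3) ≤ h * ((4 * R) ^ 2 / ((τ + 1 : ℕ) : ℝ)) := by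
    have e : h * ((4 * R) ^ 2 / ((τ + 1 : ℕ) : ℝ)) = 4 * D / ((τ : ℝ) + 1) := by
      rw [hD]; push_cast; ring
    rw [e]
    exact div_le_div_of_nonneg_left (by positivity) (by positivity) (by linarith)
  exact le_of_mul_le_mul_left (h3.trans h4) h0

end regularized

/-! ### Independence of the past -/

section fresh

variable {Ω : Type*} {m₀ mΩ : MeasurableSpace Ω} {μ : Measure Ω} [IsProbabilityMeasure μ]

lemma sq_integral_le_integral_sq {φ : Ω → ℝ} (h1 : Integrable φ μ)
    (h2 : Integrable (fun ω => φ ω ^ 2) μ) : (∫ ω, φ ω ∂μ) ^ 2 ≤ ∫ ω, φ ω ^ 2 ∂μ := by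
  set c := ∫ ω, φ ω ∂μ with hc
  have h3 : 0 ≤ ∫ ω, (φ ω - c) ^ 2 ∂μ := integral_nonneg fun ω => sq_nonneg _
  have h4 : ∫ ω, (φ ω - c) ^ 2 ∂μ = ∫ ω, φ ω ^ 2 ∂μ - c ^ 2 := by
    have e : ∀ ω, (φ ω - c) ^ 2 = φ ω ^ 2 + (c ^ 2 - 2 * c * φ ω) := fun ω => by ring
    simp only [e]
    have i1 : Integrable (fun ω => 2 * c * φ ω) μ := h1.const_mul _
    have i2 : Integrable (fun ω => c ^ 2 - 2 * c * φ ω) μ := (integrable_const _).sub i1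
    rw [integral_add h2 i2, integral_sub (integrable_const _) i1, integral_const_mul, ← hc]
    simp
    ring
  linarith

/-- Fubini for a variable that is independent of the past. -/
lemma integral_comp_fresh {d : ℕ} (hm₀ : m₀ ≤ mΩ) {β : Type*}
    [MeasurableSpace β] {X : Ω → β} (hX : Measurable[m₀] X) {u : Ω → Sph d} (hum : Measurable u)
    (hu : HasLaw u (uniformSphere d) μ)
    (hind : Indep (MeasurableSpace.comap u inferInstance) m₀ μ) {Ψ : β × Sph d → ℝ}
    (hΨ : Measurable Ψ) (hint : Integrable (fun ω => Ψ (X ω, u ω)) μ) :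
    Integrable (fun ω => ∫ v, Ψ (X ω, v) ∂uniformSphere d) μ ∧
      ∫ ω, Ψ (X ω, u ω) ∂μ = ∫ ω, ∫ v, Ψ (X ω, v) ∂uniformSphere d ∂μ := by
  have hXm : Measurable X := hX.mono hm₀ le_rfl
  have hIF : IndepFun X u μ := by
    rw [IndepFun_iff_Indep]
    exact (indep_of_indep_of_le_right hind hX.comap_le).symm
  have hprod := (indepFun_iff_map_prod_eq_prod_map_map hXm.aemeasurable hum.aemeasurable).1 hIF
  rw [hu.map_eq] at hprod
  have hpr : IsProbabilityMeasure (uniformSphere d) := by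
    rw [← hu.map_eq]; exact Measure.isProbabilityMeasure_map hum.aemeasurable
  have hprX : IsProbabilityMeasure (μ.map X) := Measure.isProbabilityMeasure_map hXm.aemeasurable
  have hmapint : Integrable Ψ ((μ.map X).prod (uniformSphere d)) := by
    rw [← hprod]
    exact (integrable_map_measure hΨ.aestronglyMeasurable (hXm.prodMk hum).aemeasurable).2 hint
  refine ⟨hmapint.integral_prod_left.comp_measurable hXm, ?_⟩
  calc ∫ ω, Ψ (X ω, u ω) ∂μ = ∫ q, Ψ q ∂(μ.map fun ω => (X ω, u ω)) :=
        (integral_map (hXm.prodMk hum).aemeasurable hΨ.aestronglyMeasurable).symm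
    _ = ∫ x, ∫ v, Ψ (x, v) ∂uniformSphere d ∂(μ.map X) := by
        rw [hprod, integral_prod _ hmapint]
    _ = _ := integral_map hXm.aemeasurable hmapint.integral_prod_left.aestronglyMeasurable

end fresh

/-! ### The structure of an execution -/

section shrink

variable {d : ℕ} {𝒦 : Set (Vec d)} {r R δ : ℝ}

/-- Exploring at distance `δ` from a point of `𝒦_δ` stays in `𝒦`. -/
lemma closedBall_subset_of_mem_shrink (h𝒦 : IsDecisionSet r R 𝒦) (hδ : 0 < δ) (hδr : δ ≤ r)
    {x : Vec d} (hx : x ∈ shrink r δ 𝒦) : Metric.closedBall x δ ⊆ 𝒦 := by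
  intro y hy
  obtain ⟨k, hk, rfl⟩ := Set.mem_smul_set.1 hx
  have hr : 0 < r := hδ.trans_le hδr
  set v := y - (1 - δ / r) • k with hv
  have hvn : ‖v‖ ≤ δ := by simpa [dist_eq_norm] using hy
  have h1 : (r / δ) • v ∈ 𝒦 := h𝒦.inner_ball (by
    rw [mem_closedBall_zero_iff, norm_smul, Real.norm_of_nonneg (by positivity), div_mul_eq_mul_div,
      div_le_iff₀ hδ]
    exact mul_le_mul_of_nonneg_left hvn hr.le)
  have h2 := h𝒦.convex hk h1 (show 0 ≤ 1 - δ / r by rw [sub_nonneg, div_le_one hr]; exact hδr)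
    (show 0 ≤ δ / r by positivity) (by ring)
  rw [smul_smul, show δ / r * (r / δ) = 1 by field_simp, one_smul] at h2
  rwa [hv, add_sub_cancel] at h2

lemma shrink_subset (h𝒦 : IsDecisionSet r R 𝒦) (hδ : 0 < δ) (hδr : δ ≤ r) :
    shrink r δ 𝒦 ⊆ 𝒦 := fun _ hx =>
  closedBall_subset_of_mem_shrink h𝒦 hδ hδr hx (Metric.mem_closedBall_self hδ.le)

lemma isCompact_shrink (h𝒦 : IsDecisionSet r R 𝒦) : IsCompact (shrink r δ 𝒦) :=
  ((isCompact_closedBall (0 : Vec d) R).of_isClosed_subset h𝒦.closed h𝒦.outer_ball).smul _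

lemma convex_shrink (h𝒦 : IsDecisionSet r R 𝒦) : Convex ℝ (shrink r δ 𝒦) := h𝒦.convex.smul _

end shrink

/-- An execution of D-BBCG on admissible data, for convex losses (`α = 0`), with `K = L` and
`T = K²`, so that there are `K` blocks. -/
structure IsAdmissibleRun {d n : ℕ} {Ω : Type*} [MeasurableSpace Ω] (r R : ℝ) (G : NNReal) (M : ℝ)
    (μ : Measure Ω) (p : Params) (E : Fin n → Fin n → Prop) (P : Matrix (Fin n) (Fin n) ℝ)
    (𝒦 : Set (Vec d)) (f : ℕ → Fin n → Vec d → ℝ) (x₀ : Vec d) (e : Execution d n Ω) : Prop where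
  dim_pos : 1 ≤ d
  learners_pos : n ≠ 0
  decisionSet : IsDecisionSet r R 𝒦
  weight : IsWeightMatrix E P
  loss : IsLossSequence 𝒦 G M p.T f
  run : e.IsDBBCG μ p E P 𝒦 r f x₀
  start_mem : x₀ ∈ shrink r p.δ 𝒦
  K_pos : 1 ≤ p.K
  L_eq : p.L = p.K
  T_eq : p.T = p.K * p.K
  α_eq : p.α = 0
  δ_pos : 0 < p.δ
  δ_le : p.δ ≤ r

namespace IsAdmissibleRun

variable {d n : ℕ} {Ω : Type*} [mΩ : MeasurableSpace Ω] {r R : ℝ} {G : NNReal} {M : ℝ}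
  {μ : Measure Ω} {p : Params} {E : Fin n → Fin n → Prop} {P : Matrix (Fin n) (Fin n) ℝ}
  {𝒦 : Set (Vec d)} {f : ℕ → Fin n → Vec d → ℝ} {x₀ : Vec d} {e : Execution d n Ω}
  (H : IsAdmissibleRun r R G M μ p E P 𝒦 f x₀ e)

include H

lemma B_eq : p.B = p.K := by
  rw [Params.B, H.T_eq, Nat.mul_div_cancel_left _ H.K_pos]

lemma surrogate_eq (m : ℕ) (z : Vec d) : p.surrogate x₀ m z = regLoss p.h x₀ z := by
  ext x
  simp [Params.surrogate, regLoss, H.α_eq]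

/-- The rounds of the blocks `1, …, K` partition the rounds `1, …, T`. -/
lemma mem_rounds {m t : ℕ} (hm : m ∈ Finset.Icc 1 p.K) (ht : t ∈ p.rounds m) :
    t ∈ Finset.Icc 1 p.T ∧ p.blockOf t = m ∧ (m - 1) * p.K ≤ t - 1 ∧ t ≤ m * p.K := by
  obtain ⟨hm1, hm2⟩ := Finset.mem_Icc.1 hm
  obtain ⟨ht1, ht2⟩ := Finset.mem_Icc.1 ht
  have h1 : m * p.K ≤ p.T := by rw [H.T_eq]; exact Nat.mul_le_mul_right _ hm2
  have h2 : m * p.K = (m - 1) * p.K + p.K := by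
    obtain ⟨k, rfl⟩ : ∃ k, m = k + 1 := ⟨m - 1, by omega⟩
    simp [add_mul]
  refine ⟨Finset.mem_Icc.2 ⟨by omega, by omega⟩, ?_, by omega, ht2⟩
  have h3 : (t - 1) / p.K = m - 1 := by
    rw [Nat.div_eq_iff H.K_pos]
    constructor
    · omega
    · have := H.K_pos; omega
  rw [Params.blockOf, h3]; omega

lemma blockOf_mem {t : ℕ} (ht : t ∈ Finset.Icc 1 p.T) :
    p.blockOf t ∈ Finset.Icc 1 p.K ∧ t ∈ p.rounds (p.blockOf t) := by
  obtain ⟨ht1, ht2⟩ := Finset.mem_Icc.1 ht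
  have hK := H.K_pos
  have h1 : (t - 1) / p.K < p.K := by
    rw [Nat.div_lt_iff_lt_mul hK, ← H.T_eq]; omega
  have h2 := Nat.div_add_mod (t - 1) p.K
  have h3 := Nat.mod_lt (t - 1) hK
  refine ⟨Finset.mem_Icc.2 ⟨by simp [Params.blockOf], by rw [Params.blockOf]; omega⟩, ?_⟩
  rw [Params.rounds, Params.blockOf, Finset.mem_Icc, Nat.add_sub_cancel, add_mul, one_mul,
    mul_comm ((t - 1) / p.K)]
  omega

lemma sum_rounds (a : ℕ → ℝ) :
    ∑ t ∈ Finset.Icc 1 p.T, a t = ∑ m ∈ Finset.Icc 1 p.K, ∑ t ∈ p.rounds m, a t := by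
  rw [← Finset.sum_fiberwise_of_maps_to (g := p.blockOf) (fun t ht => (H.blockOf_mem ht).1)]
  refine Finset.sum_congr rfl fun m hm => Finset.sum_congr ?_ fun _ _ => rfl
  ext t
  rw [Finset.mem_filter]
  constructor
  · rintro ⟨ht, rfl⟩
    exact (H.blockOf_mem ht).2
  · intro ht
    have := H.mem_rounds hm ht
    exact ⟨this.1, this.2.1⟩

/-- The losses are only controlled on `𝒦`. A global Lipschitz extension makes them measurable. -/
lemma exists_lipschitz_extension {t : ℕ} (ht : t ∈ Finset.Icc 1 p.T) (i : Fin n) :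
    ∃ F : Vec d → ℝ, LipschitzWith G F ∧ Set.EqOn (f t i) F 𝒦 ∧ ConvexOn ℝ 𝒦 F := by
  have h1 : LipschitzOnWith G (f t i) 𝒦 := LipschitzOnWith.of_dist_le_mul fun x hx y hy => by
    rw [Real.dist_eq, dist_eq_norm]; exact H.loss.lipschitz t ht i x hx y hy
  obtain ⟨F, hF, hFe⟩ := h1.extend_real
  exact ⟨F, hF, hFe, (H.loss.convex t ht i).congr hFe⟩

lemma cg_spec {m : ℕ} (hm : m ∈ Finset.Icc 1 p.K) (i : Fin n) (ω : Ω) :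
    IsCGRun (shrink r p.δ 𝒦) p.K (regLoss p.h x₀ (e.z i m ω)) (e.x i m ω)
      (fun τ => e.c i m τ ω) (fun τ => e.v i m τ ω) (fun τ => e.s i m τ ω) := by
  have := H.run.cg m (by rwa [H.B_eq]) i ω
  rwa [H.surrogate_eq, H.L_eq] at this

lemma isRegMin_regMin (z : Vec d) :
    IsRegMin (shrink r p.δ 𝒦) p.h x₀ z (regMin (shrink r p.δ 𝒦) p.h x₀ z) :=
  BanditCG.isRegMin_regMin (isCompact_shrink H.decisionSet) (convex_shrink H.decisionSet)
    ⟨x₀, H.start_mem⟩ z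

lemma shrink_subset_closedBall : shrink r p.δ 𝒦 ⊆ Metric.closedBall 0 R :=
  (shrink_subset H.decisionSet H.δ_pos H.δ_le).trans H.decisionSet.outer_ball

lemma x_mem (i : Fin n) (ω : Ω) {m : ℕ} (hm : m ∈ Finset.Icc 1 (p.K + 1)) :
    e.x i m ω ∈ shrink r p.δ 𝒦 := by
  obtain ⟨hm1, hm2⟩ := Finset.mem_Icc.1 hm
  induction m, hm1 using Nat.le_induction with
  | base => rw [H.run.x_init]; exact H.start_mem
  | succ m hm1 ih =>
    have hm' : m ∈ Finset.Icc 1 p.K := Finset.mem_Icc.2 ⟨hm1, by omega⟩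
    have hx := ih (Finset.mem_Icc.2 ⟨hm1, by omega⟩) (by omega)
    rw [H.run.x_step m (by rwa [H.B_eq]), H.L_eq]
    exact (H.cg_spec hm' i ω).mem (convex_shrink H.decisionSet) hx _ le_rfl

omit H in
lemma norm_u (i : Fin n) (t : ℕ) (ω : Ω) : ‖(e.u i t ω : Vec d)‖ = 1 := by simp

lemma y_mem (i : Fin n) (ω : Ω) {t : ℕ} (ht : t ∈ Finset.Icc 1 p.T) : e.y p i t ω ∈ 𝒦 := by
  have hm := Finset.mem_Icc.1 (H.blockOf_mem ht).1
  have hx := H.x_mem i ω (Finset.mem_Icc.2 ⟨hm.1, hm.2.trans (Nat.le_succ _)⟩)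
  refine closedBall_subset_of_mem_shrink H.decisionSet H.δ_pos H.δ_le hx ?_
  rw [Execution.y, Metric.mem_closedBall, dist_eq_norm, add_sub_cancel_left, norm_smul,
    norm_u, mul_one, Real.norm_of_nonneg H.δ_pos.le]

lemma z_step {m : ℕ} (hm : m ∈ Finset.Icc 1 p.K) (i : Fin n) (ω : Ω) :
    e.z i (m + 1) ω = ∑ j, P i j • e.z j m ω + e.gHat p f i m ω := by
  rw [H.run.z_step m (by rwa [H.B_eq]), H.α_eq, zero_mul, zero_smul, sub_zero]
  congr 1
  rw [neighbors, Finset.sum_filter]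
  refine Finset.sum_congr rfl fun j _ => ?_
  by_cases hE : E i j
  · rw [if_pos hE, Execution.msg, if_pos ⟨Dvd.intro_left m rfl, H.weight.undirected i j hE⟩,
      Option.getD_some, Nat.mul_div_cancel _ H.K_pos]
  · have : P i j = 0 := le_antisymm
      (not_lt.1 fun h => hE (H.weight.supported i j h))
      ((mem_doublyStochastic.1 H.weight.stochastic).1 i j)
    rw [if_neg hE, this, zero_smul]

lemma norm_g_le (i : Fin n) (ω : Ω) {t : ℕ} (ht : t ∈ Finset.Icc 1 p.T) :
    ‖e.g p f i t ω‖ ≤ d / p.δ * M := by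
  have h := H.loss.bounded t ht i _ (H.y_mem i ω ht)
  have hδ := H.δ_pos
  rw [Execution.g, norm_smul, norm_u, mul_one, norm_mul, Real.norm_of_nonneg (by positivity)]
  exact mul_le_mul_of_nonneg_left h (by positivity)

lemma measurable_g (i : Fin n) {t : ℕ} (ht : t ∈ Finset.Icc 1 p.T)
    (hx : Measurable[e.ℋ t] (e.x i (p.blockOf t))) : Measurable[e.ℋ t] (e.g p f i t) := by
  obtain ⟨F, hF, hFe, -⟩ := H.exists_lipschitz_extension ht i
  have hu : Measurable[e.ℋ t] fun ω => (e.u i t ω : Vec d) :=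
    measurable_subtype_coe.comp (H.run.u_history t ht i)
  have h1 : e.g p f i t = fun ω => ((d : ℝ) / p.δ
      * F (e.x i (p.blockOf t) ω + p.δ • (e.u i t ω : Vec d))) • (e.u i t ω : Vec d) := by
    ext1 ω
    rw [Execution.g, hFe (H.y_mem i ω ht)]; rfl
  rw [h1]
  exact ((hF.continuous.measurable.comp (hx.add (hu.const_smul p.δ))).const_mul _).smul hu

/-- The state at the beginning of block `m` is determined by the history before that block. -/
lemma measurable_state {m : ℕ} (hm : m ∈ Finset.Icc 1 (p.K + 1)) :
    (∀ i, Measurable[e.ℋ ((m - 1) * p.K)] (e.x i m)) ∧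
      ∀ i, Measurable[e.ℋ ((m - 1) * p.K)] (e.z i m) := by
  obtain ⟨hm1, hm2⟩ := Finset.mem_Icc.1 hm
  induction m, hm1 using Nat.le_induction with
  | base =>
    refine ⟨fun i => ?_, fun i => ?_⟩
    · rw [show e.x i 1 = fun _ => x₀ from funext (H.run.x_init i)]; exact measurable_const
    · rw [show e.z i 1 = fun _ => 0 from funext (H.run.z_init i)]; exact measurable_const
  | succ m hm1 ih =>
    have hmK : m ∈ Finset.Icc 1 p.K := Finset.mem_Icc.2 ⟨hm1, by omega⟩
    have hmB : m ∈ Finset.Icc 1 p.B := by rwa [H.B_eq]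
    obtain ⟨ihx, ihz⟩ := ih (Finset.mem_Icc.2 ⟨hm1, by omega⟩) (by omega)
    have hle : e.ℋ ((m - 1) * p.K) ≤ e.ℋ (m * p.K) :=
      e.ℋ.mono (Nat.mul_le_mul_right _ (Nat.sub_le _ _))
    rw [Nat.add_sub_cancel]
    refine ⟨fun i => ?_, fun i => ?_⟩
    · have hc : ∀ τ ≤ p.L, Measurable[e.ℋ (m * p.K)] (e.c i m τ) := by
        intro τ hτ
        induction τ with
        | zero =>
          rw [show e.c i m 0 = e.x i m from funext fun ω => (H.run.cg m hmB i ω).init]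
          exact (ihx i).mono hle le_rfl
        | succ τ ih =>
          rw [show e.c i m (τ + 1) = fun ω => e.c i m τ ω
              + e.s i m τ ω • (e.v i m τ ω - e.c i m τ ω) from
            funext fun ω => (H.run.cg m hmB i ω).step τ hτ]
          have h1 := ih (by omega)
          exact h1.add ((H.run.s_history m hmB i τ hτ).smul
            ((H.run.v_history m hmB i τ hτ).sub h1))
      rw [show e.x i (m + 1) = e.c i m p.L from funext (H.run.x_step m hmB i)]
      exact hc _ le_rfl
    · rw [show e.z i (m + 1) = fun ω => ∑ j, P i j • e.z j m ω + e.gHat p f i m ω from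
        funext (H.z_step hmK i)]
      refine Measurable.add (Finset.measurable_fun_sum _ fun j _ =>
        ((ihz j).mono hle le_rfl).const_smul (P i j)) ?_
      refine Finset.measurable_fun_sum _ fun t ht => ?_
      obtain ⟨h1, h2, h3, h4⟩ := H.mem_rounds hmK ht
      refine (H.measurable_g i h1 ?_).mono (e.ℋ.mono h4) le_rfl
      rw [h2]
      exact (ihx i).mono (e.ℋ.mono (h3.trans (Nat.sub_le _ _))) le_rfl

end IsAdmissibleRun

/-! ### Moments of the gradient estimates -/

namespace IsAdmissibleRun

variable {d n : ℕ} {Ω : Type*} [mΩ : MeasurableSpace Ω] {r R : ℝ} {G : NNReal} {M : ℝ}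
  {μ : Measure Ω} [IsProbabilityMeasure μ] {p : Params} {E : Fin n → Fin n → Prop}
  {P : Matrix (Fin n) (Fin n) ℝ} {𝒦 : Set (Vec d)} {f : ℕ → Fin n → Vec d → ℝ} {x₀ : Vec d}
  {e : Execution d n Ω} (H : IsAdmissibleRun r R G M μ p E P 𝒦 f x₀ e)

include H

omit [IsProbabilityMeasure μ] in
lemma measurable_x_past (i : Fin n) {t : ℕ} (ht : t ∈ Finset.Icc 1 p.T) :
    Measurable[e.ℋ (t - 1)] (e.x i (p.blockOf t)) := by
  obtain ⟨hm, htm⟩ := H.blockOf_mem ht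
  have hm' := Finset.mem_Icc.1 hm
  exact ((H.measurable_state (Finset.mem_Icc.2 ⟨hm'.1, hm'.2.trans (Nat.le_succ _)⟩)).1 i).mono
    (e.ℋ.mono (H.mem_rounds hm htm).2.2.1) le_rfl

omit [IsProbabilityMeasure μ] in
lemma measurable_g_history (i : Fin n) {t : ℕ} (ht : t ∈ Finset.Icc 1 p.T) :
    Measurable[e.ℋ t] (e.g p f i t) :=
  H.measurable_g i ht ((H.measurable_x_past i ht).mono (e.ℋ.mono (Nat.sub_le _ _)) le_rfl)

omit [IsProbabilityMeasure μ] in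
lemma integrable_inner_g (i : Fin n) {t : ℕ} (ht : t ∈ Finset.Icc 1 p.T) {Y : Ω → Vec d}
    (hY : Measurable Y) (hYi : Integrable (fun ω => ‖Y ω‖) μ) :
    Integrable (fun ω => ⟪e.g p f i t ω, Y ω⟫) μ := by
  have hg : Measurable (e.g p f i t) := (H.measurable_g_history i ht).mono (e.ℋ.le t) le_rfl
  refine (hYi.const_mul (d / p.δ * M)).mono' (hg.inner hY).aestronglyMeasurable
    (.of_forall fun ω => ?_)
  exact (abs_real_inner_le_norm _ _).trans
    (mul_le_mul_of_nonneg_right (H.norm_g_le i ω ht) (norm_nonneg _))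

/-- Averaging the estimate of round `t` over the fresh direction, given the past. -/
lemma integral_inner_g_eq (i : Fin n) {t : ℕ} (ht : t ∈ Finset.Icc 1 p.T) {Y : Ω → Vec d}
    (hY : Measurable[e.ℋ (t - 1)] Y) (hYi : Integrable (fun ω => ‖Y ω‖) μ) {F : Vec d → ℝ}
    (hF : LipschitzWith G F) (hFe : Set.EqOn (f t i) F 𝒦) :
    Integrable (fun ω => d / p.δ * ∫ v : Sph d, F (e.x i (p.blockOf t) ω + p.δ • (v : Vec d))
        * ⟪(v : Vec d), Y ω⟫ ∂uniformSphere d) μ ∧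
    ∫ ω, ⟪e.g p f i t ω, Y ω⟫ ∂μ
      = ∫ ω, d / p.δ * ∫ v : Sph d, F (e.x i (p.blockOf t) ω + p.δ • (v : Vec d))
        * ⟪(v : Vec d), Y ω⟫ ∂uniformSphere d ∂μ := by
  set Ψ : (Vec d × Vec d) × Sph d → ℝ := fun q =>
    d / p.δ * (F (q.1.1 + p.δ • (q.2 : Vec d)) * ⟪(q.2 : Vec d), q.1.2⟫) with hΨ
  have hFc := hF.continuous
  have hΨm : Measurable Ψ := Continuous.measurable (by rw [hΨ]; fun_prop)
  have heq : ∀ ω, ⟪e.g p f i t ω, Y ω⟫ = Ψ ((e.x i (p.blockOf t) ω, Y ω), e.u i t ω) := fun ω => by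
    rw [Execution.g, hFe (H.y_mem i ω ht), inner_smul_left, hΨ]
    simp only [conj_trivial, mul_assoc]; rfl
  have hint := H.integrable_inner_g i ht (hY.mono (e.ℋ.le _) le_rfl) hYi
  simp only [heq] at hint ⊢
  have := integral_comp_fresh (e.ℋ.le (t - 1)) ((H.measurable_x_past i ht).prodMk hY)
    ((H.run.u_history t ht i).mono (e.ℋ.le t) le_rfl) (H.run.u_law t ht i)
    (indep_of_indep_of_le_left (H.run.u_fresh t ht)
      (le_iSup (fun j => MeasurableSpace.comap (e.u j t) inferInstance) i)) hΨm hint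
  simpa only [hΨ, integral_const_mul] using this

lemma integral_inner_g_le (i : Fin n) {t : ℕ} (ht : t ∈ Finset.Icc 1 p.T) {Y : Ω → Vec d}
    (hY : Measurable[e.ℋ (t - 1)] Y) (hYi : Integrable (fun ω => ‖Y ω‖) μ) :
    ∫ ω, ⟪e.g p f i t ω, Y ω⟫ ∂μ ≤ d * G * ∫ ω, ‖Y ω‖ ∂μ := by
  obtain ⟨F, hF, hFe, -⟩ := H.exists_lipschitz_extension ht i
  obtain ⟨h1, h2⟩ := H.integral_inner_g_eq i ht hY hYi hF hFe
  rw [h2, ← integral_const_mul]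
  exact integral_mono h1 (hYi.const_mul _) fun ω =>
    integral_estimator_le H.dim_pos hF H.δ_pos _ _

omit [IsProbabilityMeasure μ] in
lemma norm_sub_le {a b : Vec d} (ha : a ∈ shrink r p.δ 𝒦) (hb : b ∈ shrink r p.δ 𝒦) :
    ‖a - b‖ ≤ 2 * R := by
  have h1 : ‖a‖ ≤ R := by simpa using H.shrink_subset_closedBall ha
  have h2 : ‖b‖ ≤ R := by simpa using H.shrink_subset_closedBall hb
  exact (_root_.norm_sub_le a b).trans (by linarith)

omit [IsProbabilityMeasure μ] in
lemma x_blockOf_mem (i : Fin n) {t : ℕ} (ht : t ∈ Finset.Icc 1 p.T) (ω : Ω) :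
    e.x i (p.blockOf t) ω ∈ shrink r p.δ 𝒦 := by
  have hm' := Finset.mem_Icc.1 (H.blockOf_mem ht).1
  exact H.x_mem i ω (Finset.mem_Icc.2 ⟨hm'.1, hm'.2.trans (Nat.le_succ _)⟩)

lemma integrable_loss (i : Fin n) {t : ℕ} (ht : t ∈ Finset.Icc 1 p.T) {X : Ω → Vec d}
    (hX : Measurable X) (hmem : ∀ ω, X ω ∈ 𝒦) : Integrable (fun ω => f t i (X ω)) μ := by
  obtain ⟨F, hF, hFe, -⟩ := H.exists_lipschitz_extension ht i
  refine Integrable.of_bound (C := M) ?_ (.of_forall fun ω => H.loss.bounded t ht i _ (hmem ω))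
  simp only [fun ω => hFe (hmem ω)]
  exact (hF.continuous.measurable.comp hX).aestronglyMeasurable

/-- In expectation, the linearized loss dominates the excess loss at the centre. -/
lemma integral_excess_le (i : Fin n) {t : ℕ} (ht : t ∈ Finset.Icc 1 p.T) {x : Vec d}
    (hx : x ∈ shrink r p.δ 𝒦) :
    ∫ ω, f t i (e.x i (p.blockOf t) ω) ∂μ - f t i x - 2 * G * p.δ
      ≤ ∫ ω, ⟪e.g p f i t ω, e.x i (p.blockOf t) ω - x⟫ ∂μ := by
  obtain ⟨F, hF, hFe, hFc⟩ := H.exists_lipschitz_extension ht i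
  have hsub := shrink_subset H.decisionSet H.δ_pos H.δ_le
  have hxm := H.measurable_x_past i ht
  have hYi : Integrable (fun ω => ‖e.x i (p.blockOf t) ω - x‖) μ :=
    Integrable.of_bound (C := 2 * R)
      ((hxm.mono (e.ℋ.le _) le_rfl).sub_const x).norm.aestronglyMeasurable
      (.of_forall fun ω => by
        rw [norm_norm]; exact H.norm_sub_le (H.x_blockOf_mem i ht ω) hx)
  obtain ⟨h1, h2⟩ := H.integral_inner_g_eq i ht (hxm.sub_const x) hYi hF hFe
  have i1 := H.integrable_loss i ht (hxm.mono (e.ℋ.le _) le_rfl)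
    fun ω => hsub (H.x_blockOf_mem i ht ω)
  have e1 : ∫ ω, f t i (e.x i (p.blockOf t) ω) ∂μ - f t i x - 2 * G * p.δ
      = ∫ ω, (f t i (e.x i (p.blockOf t) ω) - (f t i x + 2 * G * p.δ)) ∂μ := by
    rw [integral_sub i1 (integrable_const _)]; simp; ring
  rw [h2, e1]
  refine integral_mono (i1.sub (integrable_const _)) h1 fun ω => ?_
  have h3 := sub_le_integral_estimator H.dim_pos hF hFc H.δ_pos
    (closedBall_subset_of_mem_shrink H.decisionSet H.δ_pos H.δ_le (H.x_blockOf_mem i ht ω))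
    (closedBall_subset_of_mem_shrink H.decisionSet H.δ_pos H.δ_le hx)
  simp only
  rw [hFe (hsub (H.x_blockOf_mem i ht ω)), hFe (hsub hx)]
  linarith

omit [IsProbabilityMeasure μ] in
lemma integrable_norm_sq_sum_g [IsFiniteMeasure μ] (i : Fin n) (s : Finset ℕ)
    (hs : s ⊆ Finset.Icc 1 p.T) :
    Integrable (fun ω => ‖∑ t ∈ s, e.g p f i t ω‖) μ ∧
      Integrable (fun ω => ‖∑ t ∈ s, e.g p f i t ω‖ ^ 2) μ := by
  have hm : Measurable fun ω => ‖∑ t ∈ s, e.g p f i t ω‖ :=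
    (Finset.measurable_fun_sum _ fun t ht =>
      (H.measurable_g_history i (hs ht)).mono (e.ℋ.le t) le_rfl).norm
  have hb : ∀ ω, ‖∑ t ∈ s, e.g p f i t ω‖ ≤ s.card * (d / p.δ * M) := fun ω => by
    rw [← nsmul_eq_mul]
    exact norm_sum_le_of_le _ (fun t ht => H.norm_g_le i ω (hs ht)) |>.trans_eq
      (Finset.sum_const _)
  refine ⟨.of_bound hm.aestronglyMeasurable _ (.of_forall fun ω => (norm_norm _).trans_le (hb ω)),
    .of_bound (hm.pow_const 2).aestronglyMeasurable ((s.card * (d / p.δ * M)) ^ 2)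
      (.of_forall fun ω => ?_)⟩
  rw [norm_pow, norm_norm]
  exact pow_le_pow_left₀ (norm_nonneg _) (hb ω) 2

lemma bound_nonneg : 0 ≤ d / p.δ * M := by
  obtain ⟨ω⟩ : Nonempty Ω := μ.nonempty_of_neZero
  have hT : 1 ∈ Finset.Icc 1 p.T := by
    rw [H.T_eq]; exact Finset.mem_Icc.2 ⟨le_rfl, Nat.mul_pos H.K_pos H.K_pos⟩
  exact (norm_nonneg _).trans (H.norm_g_le ⟨0, Nat.pos_of_ne_zero H.learners_pos⟩ ω hT)

/-- The root mean square bound for the block estimates. The fluctuations of the `K` estimates add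
up like `√K`, only their conditional means, of norm at most `d G`, add up like `K`. -/
lemma integral_norm_gHat_sq_le (i : Fin n) {m : ℕ} (hm : m ∈ Finset.Icc 1 p.K) :
    ∫ ω, ‖e.gHat p f i m ω‖ ^ 2 ∂μ ≤ (√p.K * (d / p.δ * M) + p.K * (d * G)) ^ 2 := by
  set b := d / p.δ * M with hb
  set D : ℝ := d * G with hD
  have hb0 : 0 ≤ b := H.bound_nonneg
  have hD0 : 0 ≤ D := by positivity
  set a := (m - 1) * p.K with ha
  have hmK : m * p.K = a + p.K := by
    obtain ⟨k, rfl⟩ : ∃ k, m = k + 1 := ⟨m - 1, by have := (Finset.mem_Icc.1 hm).1; omega⟩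
    simp [ha, add_mul]
  have hsub : ∀ k ≤ p.K, Finset.Icc (a + 1) (a + k) ⊆ Finset.Icc 1 p.T := fun k hk t ht => by
    refine (H.mem_rounds hm ?_).1
    rw [Params.rounds, hmK]
    exact Finset.Icc_subset_Icc_right (by omega) ht
  have key : ∀ k ≤ p.K, ∫ ω, ‖∑ t ∈ Finset.Icc (a + 1) (a + k), e.g p f i t ω‖ ^ 2 ∂μ
      ≤ (√k * b + k * D) ^ 2 := by
    intro k hk
    induction k with
    | zero => simp
    | succ k ih =>
      have ih := ih (by omega)
      obtain ⟨i1, i2⟩ := H.integrable_norm_sq_sum_g i _ (hsub k (by omega))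
      set S := fun ω => ∑ t ∈ Finset.Icc (a + 1) (a + k), e.g p f i t ω with hS
      have ht : a + (k + 1) ∈ Finset.Icc 1 p.T :=
        hsub (k + 1) hk (Finset.mem_Icc.2 ⟨by omega, le_rfl⟩)
      have hSm : Measurable[e.ℋ (a + (k + 1) - 1)] S := by
        refine Finset.measurable_fun_sum _ fun t ht => ?_
        refine (H.measurable_g_history i (hsub k (by omega) ht)).mono (e.ℋ.mono ?_) le_rfl
        have := (Finset.mem_Icc.1 ht).2
        omega
      have j1 := H.integrable_inner_g i ht (hSm.mono (e.ℋ.le _) le_rfl) i1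
      have j2 := H.integral_inner_g_le i ht hSm i1
      have j3 : ∫ ω, ‖S ω‖ ∂μ ≤ √k * b + k * D :=
        le_of_sq_le_sq ((sq_integral_le_integral_sq i1 i2).trans ih) (by positivity)
      have e1 : ∀ ω, ‖∑ t ∈ Finset.Icc (a + 1) (a + (k + 1)), e.g p f i t ω‖ ^ 2
          ≤ ‖S ω‖ ^ 2 + (2 * ⟪e.g p f i (a + (k + 1)) ω, S ω⟫ + b ^ 2) := fun ω => by
        rw [← add_assoc a k 1, Finset.sum_Icc_succ_top (by omega), norm_add_sq_real,
          real_inner_comm]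
        have := pow_le_pow_left₀ (norm_nonneg _) (H.norm_g_le i ω ht) 2
        rw [← add_assoc a k 1] at this
        linarith
      obtain ⟨-, i3⟩ := H.integrable_norm_sq_sum_g i _ (hsub (k + 1) hk)
      have j4 : Integrable (fun ω => 2 * ⟪e.g p f i (a + (k + 1)) ω, S ω⟫ + b ^ 2) μ :=
        (j1.const_mul 2).add (integrable_const _)
      have e2 := integral_mono i3 (i2.add j4) e1
      refine e2.trans ?_
      rw [integral_add' i2 j4, integral_add (j1.const_mul 2) (integrable_const _),
        integral_const_mul, integral_const]
      rw [probReal_univ, one_smul]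
      have s1 : √(k : ℝ) ^ 2 = k := Real.sq_sqrt (by positivity)
      have s2 : √((k + 1 : ℕ) : ℝ) ^ 2 = k + 1 := by rw [Real.sq_sqrt (by positivity)]; simp
      have s3 : √(k : ℝ) ≤ √((k + 1 : ℕ) : ℝ) := Real.sqrt_le_sqrt (by push_cast; linarith)
      have s4 : D * ∫ ω, ‖S ω‖ ∂μ ≤ D * (√k * b + k * D) := mul_le_mul_of_nonneg_left j3 hD0
      have s5 : √(k : ℝ) * (b * D * (k + 1)) ≤ √((k + 1 : ℕ) : ℝ) * (b * D * (k + 1)) :=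
        mul_le_mul_of_nonneg_right s3 (by positivity)
      have e3 : (√((k + 1 : ℕ) : ℝ) * b + ((k + 1 : ℕ) : ℝ) * D) ^ 2
          = (k + 1) * b ^ 2 + 2 * (√((k + 1 : ℕ) : ℝ) * (b * D * (k + 1)))
            + (k + 1) ^ 2 * D ^ 2 := by
        have : (√((k + 1 : ℕ) : ℝ) * b + ((k + 1 : ℕ) : ℝ) * D) ^ 2
            = √((k + 1 : ℕ) : ℝ) ^ 2 * b ^ 2
              + 2 * (√((k + 1 : ℕ) : ℝ) * (b * D * ((k + 1 : ℕ) : ℝ)))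
              + ((k + 1 : ℕ) : ℝ) ^ 2 * D ^ 2 := by ring
        rw [this, s2, Nat.cast_succ]
      have e4 : (√(k : ℝ) * b + k * D) ^ 2
          = k * b ^ 2 + 2 * (√(k : ℝ) * (b * D * k)) + k ^ 2 * D ^ 2 := by
        have : (√(k : ℝ) * b + k * D) ^ 2
          = √(k : ℝ) ^ 2 * b ^ 2 + 2 * (√(k : ℝ) * (b * D * k)) + k ^ 2 * D ^ 2 := by ring
        rw [this, s1]
      have : 0 ≤ D ^ 2 := sq_nonneg _
      rw [e3]
      rw [e4] at ih
      linarith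
  have := key p.K le_rfl
  rwa [← hmK] at this

lemma integrable_norm_gHat (i : Fin n) {m : ℕ} (hm : m ∈ Finset.Icc 1 p.K) :
    Integrable (fun ω => ‖e.gHat p f i m ω‖) μ ∧
      Integrable (fun ω => ‖e.gHat p f i m ω‖ ^ 2) μ :=
  H.integrable_norm_sq_sum_g i _ fun _ ht => (H.mem_rounds hm ht).1

omit [IsProbabilityMeasure μ] in
lemma measurable_gHat (i : Fin n) {m : ℕ} (hm : m ∈ Finset.Icc 1 p.K) :
    Measurable (e.gHat p f i m) :=
  Finset.measurable_fun_sum _ fun t ht =>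
    (H.measurable_g_history i (H.mem_rounds hm ht).1).mono (e.ℋ.le t) le_rfl

omit [IsProbabilityMeasure μ] in
lemma measurable_z (i : Fin n) {m : ℕ} (hm : m ∈ Finset.Icc 1 (p.K + 1)) :
    Measurable (e.z i m) :=
  ((H.measurable_state hm).2 i).mono (e.ℋ.le _) le_rfl

end IsAdmissibleRun

/-! ### Distance of the centres from the leader -/

/-- The point that follow-the-regularized-leader would play in block `m` if it knew the average
of all dual vectors. -/
noncomputable def Execution.leader {d n : ℕ} {Ω : Type*} [MeasurableSpace Ω]
    (e : Execution d n Ω) (p : Params) (𝒦 : Set (Vec d)) (r : ℝ) (x₀ : Vec d) (m : ℕ) (ω : Ω) :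
    Vec d :=
  regMin (shrink r p.δ 𝒦) p.h x₀ (avg fun j => e.z j m ω)

/-- The Euclidean distance of the dual vectors in block `m` from consensus. -/
noncomputable def Execution.disagreement {d n : ℕ} {Ω : Type*} [MeasurableSpace Ω]
    (e : Execution d n Ω) (m : ℕ) (ω : Ω) : ℝ :=
  stackNorm fun i => e.z i m ω - avg fun j => e.z j m ω

/-- A bound for the root mean square of the gradient estimate that a learner sums up over one
block. -/
noncomputable def blockBound (d : ℕ) (G : NNReal) (M : ℝ) (p : Params) : ℝ :=
  √p.K * (d / p.δ * M) + p.K * (d * G)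

/-- An admissible run whose regularizer is nontrivial. -/
structure IsRegularizedRun {d n : ℕ} {Ω : Type*} [MeasurableSpace Ω] (r R : ℝ) (G : NNReal)
    (M : ℝ) (μ : Measure Ω) (p : Params) (E : Fin n → Fin n → Prop)
    (P : Matrix (Fin n) (Fin n) ℝ) (𝒦 : Set (Vec d)) (f : ℕ → Fin n → Vec d → ℝ) (x₀ : Vec d)
    (e : Execution d n Ω) : Prop extends IsAdmissibleRun r R G M μ p E P 𝒦 f x₀ e where
  h_pos : 0 < p.h

namespace IsRegularizedRun

variable {d n : ℕ} {Ω : Type*} [mΩ : MeasurableSpace Ω] {r R : ℝ} {G : NNReal} {M : ℝ}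
  {μ : Measure Ω} [IsProbabilityMeasure μ] {p : Params} {E : Fin n → Fin n → Prop}
  {P : Matrix (Fin n) (Fin n) ℝ} {𝒦 : Set (Vec d)} {f : ℕ → Fin n → Vec d → ℝ} {x₀ : Vec d}
  {e : Execution d n Ω} (H : IsRegularizedRun r R G M μ p E P 𝒦 f x₀ e)

include H

lemma blockBound_nonneg : 0 ≤ blockBound d G M p :=
  add_nonneg (mul_nonneg (Real.sqrt_nonneg _) H.bound_nonneg) (by positivity)

lemma integrable_stackNorm_gHat {m : ℕ} (hm : m ∈ Finset.Icc 1 p.K) :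
    Integrable (fun ω => stackNorm fun i => e.gHat p f i m ω) μ ∧
      Integrable (fun ω => stackNorm (fun i => e.gHat p f i m ω) ^ 2) μ ∧
      ∫ ω, stackNorm (fun i => e.gHat p f i m ω) ^ 2 ∂μ ≤ n * blockBound d G M p ^ 2 := by
  have h2 : Integrable (fun ω => stackNorm (fun i => e.gHat p f i m ω) ^ 2) μ := by
    simp only [stackNorm_sq]
    exact integrable_finsetSum _ fun i _ => (H.integrable_norm_gHat i hm).2
  refine ⟨(h2.add (integrable_const 1)).mono' ?_ (.of_forall fun ω => ?_), h2, ?_⟩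
  · exact (Finset.measurable_fun_sum _ fun i _ =>
      (H.measurable_gHat i hm).norm.pow_const 2).sqrt.aestronglyMeasurable
  · rw [Real.norm_of_nonneg (stackNorm_nonneg _)]
    simp only [Pi.add_apply]
    nlinarith [sq_nonneg (stackNorm (fun i => e.gHat p f i m ω) - 1),
      stackNorm_nonneg (fun i => e.gHat p f i m ω)]
  · simp only [stackNorm_sq]
    rw [integral_finsetSum _ fun i _ => (H.integrable_norm_gHat i hm).2]
    refine (Finset.sum_le_sum fun i _ => H.integral_norm_gHat_sq_le i hm).trans_eq ?_
    simp [blockBound]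

lemma integral_stackNorm_gHat_le {m : ℕ} (hm : m ∈ Finset.Icc 1 p.K) :
    ∫ ω, stackNorm (fun i => e.gHat p f i m ω) ∂μ ≤ √n * blockBound d G M p := by
  obtain ⟨h1, h2, h3⟩ := H.integrable_stackNorm_gHat hm
  refine le_of_sq_le_sq ((sq_integral_le_integral_sq h1 h2).trans ?_)
    (mul_nonneg (Real.sqrt_nonneg _) H.blockBound_nonneg)
  rwa [mul_pow, Real.sq_sqrt (by positivity)]

lemma integrable_avg_gHat {m : ℕ} (hm : m ∈ Finset.Icc 1 p.K) :
    Integrable (fun ω => ‖avg fun i => e.gHat p f i m ω‖) μ ∧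
      Integrable (fun ω => ‖avg fun i => e.gHat p f i m ω‖ ^ 2) μ ∧
      ∫ ω, ‖avg fun i => e.gHat p f i m ω‖ ^ 2 ∂μ ≤ blockBound d G M p ^ 2 := by
  obtain ⟨-, h2, h3⟩ := H.integrable_stackNorm_gHat hm
  have hn : (1 : ℝ) ≤ n := by exact_mod_cast Nat.one_le_iff_ne_zero.2 H.learners_pos
  have hle : ∀ ω, n * ‖avg fun i => e.gHat p f i m ω‖ ^ 2
      ≤ stackNorm (fun i => e.gHat p f i m ω) ^ 2 := fun ω => by
    rw [stackNorm_sq]; exact norm_avg_sq_le H.learners_pos _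
  have hmeas : Measurable fun ω => ‖avg fun i => e.gHat p f i m ω‖ :=
    ((Finset.measurable_fun_sum _ fun i _ => H.measurable_gHat i hm).const_smul (n : ℝ)⁻¹).norm
  have i2 : Integrable (fun ω => ‖avg fun i => e.gHat p f i m ω‖ ^ 2) μ := by
    refine h2.mono' (hmeas.pow_const 2).aestronglyMeasurable (.of_forall fun ω => ?_)
    rw [Real.norm_of_nonneg (sq_nonneg _)]
    exact (le_mul_of_one_le_left (sq_nonneg _) hn).trans (hle ω)
  refine ⟨(i2.add (integrable_const 1)).mono' hmeas.aestronglyMeasurable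
    (.of_forall fun ω => ?_), i2, ?_⟩
  · rw [norm_norm]
    simp only [Pi.add_apply]
    nlinarith [sq_nonneg (‖avg fun i => e.gHat p f i m ω‖ - 1),
      norm_nonneg (avg fun i => e.gHat p f i m ω)]
  · have h4 := integral_mono (i2.const_mul (n : ℝ)) h2 hle
    rw [integral_const_mul] at h4
    exact le_of_mul_le_mul_left (h4.trans h3) (by linarith)

lemma integral_norm_avg_gHat_le {m : ℕ} (hm : m ∈ Finset.Icc 1 p.K) :
    ∫ ω, ‖avg fun i => e.gHat p f i m ω‖ ∂μ ≤ blockBound d G M p := by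
  obtain ⟨h1, h2, h3⟩ := H.integrable_avg_gHat hm
  exact le_of_sq_le_sq ((sq_integral_le_integral_sq h1 h2).trans h3) H.blockBound_nonneg

omit [IsProbabilityMeasure μ] in
lemma avg_z_succ {m : ℕ} (hm : m ∈ Finset.Icc 1 p.K) (ω : Ω) :
    (avg fun j => e.z j (m + 1) ω) = (avg fun j => e.z j m ω) + avg fun j => e.gHat p f j m ω := by
  simp only [H.z_step hm]
  rw [avg_add (fun i => ∑ j, P i j • e.z j m ω), avg_mix H.weight]

omit [IsProbabilityMeasure μ] in
lemma measurable_avg_z {m : ℕ} (hm : m ∈ Finset.Icc 1 (p.K + 1)) :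
    Measurable[e.ℋ ((m - 1) * p.K)] fun ω => avg fun j => e.z j m ω :=
  (Finset.measurable_fun_sum _ fun i _ => (H.measurable_state hm).2 i).const_smul (n : ℝ)⁻¹

omit [IsProbabilityMeasure μ] in
lemma measurable_disagreement {m : ℕ} (hm : m ∈ Finset.Icc 1 (p.K + 1)) :
    Measurable (e.disagreement m) :=
  (Finset.measurable_fun_sum _ fun i _ => (((H.measurable_z i hm).sub
    ((H.measurable_avg_z hm).mono (e.ℋ.le _) le_rfl)).norm.pow_const 2)).sqrt

lemma integral_disagreement_le {m : ℕ} (hm : m ∈ Finset.Icc 1 (p.K + 1)) :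
    Integrable (e.disagreement m) μ ∧
      ∫ ω, e.disagreement m ω ∂μ ≤ √n * blockBound d G M p / (1 - sigma2 P) := by
  have hσ : 0 < 1 - sigma2 P := by linarith [H.weight.gap]
  have hA : 0 ≤ √n * blockBound d G M p := mul_nonneg (Real.sqrt_nonneg _) H.blockBound_nonneg
  obtain ⟨hm1, hm2⟩ := Finset.mem_Icc.1 hm
  induction m, hm1 using Nat.le_induction with
  | base =>
    have : e.disagreement 1 = fun _ => (0 : ℝ) := by
      ext ω
      simp [Execution.disagreement, H.run.z_init, avg, stackNorm]
    rw [this]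
    exact ⟨integrable_const _, by simp only [integral_zero]; positivity⟩
  | succ m hm1 ih =>
    have hmK : m ∈ Finset.Icc 1 p.K := Finset.mem_Icc.2 ⟨hm1, by omega⟩
    obtain ⟨i1, b1⟩ := ih (Finset.mem_Icc.2 ⟨hm1, by omega⟩) (by omega)
    have i2 := (H.integrable_stackNorm_gHat hmK).1
    have b2 := H.integral_stackNorm_gHat_le hmK
    have hle : ∀ ω, e.disagreement (m + 1) ω
        ≤ sigma2 P * e.disagreement m ω + stackNorm fun i => e.gHat p f i m ω := fun ω => by
      rw [Execution.disagreement]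
      simp only [H.z_step hmK]
      exact stackNorm_mix_add_sub_avg_le H.learners_pos H.weight _ _
    have i3 := (i1.const_mul (sigma2 P)).add i2
    have i4 : Integrable (e.disagreement (m + 1)) μ :=
      i3.mono' (H.measurable_disagreement hm).aestronglyMeasurable (.of_forall fun ω => by
        exact (Real.norm_of_nonneg (stackNorm_nonneg _)).trans_le (hle ω))
    refine ⟨i4, (integral_mono i4 i3 hle).trans ?_⟩
    rw [integral_add' (i1.const_mul _) i2, integral_const_mul]
    have h1 := mul_le_mul_of_nonneg_left b1 (sigma2_nonneg P)
    have h2 : sigma2 P * (√n * blockBound d G M p / (1 - sigma2 P)) + √n * blockBound d G M p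
        = √n * blockBound d G M p / (1 - sigma2 P) := by field_simp; ring
    linarith

omit [IsProbabilityMeasure μ] in
lemma leader_mem (m : ℕ) (ω : Ω) : e.leader p 𝒦 r x₀ m ω ∈ shrink r p.δ 𝒦 :=
  (H.isRegMin_regMin _).1

omit [IsProbabilityMeasure μ] in
lemma measurable_leader {m : ℕ} (hm : m ∈ Finset.Icc 1 (p.K + 1)) :
    Measurable[e.ℋ ((m - 1) * p.K)] (e.leader p 𝒦 r x₀ m) := by
  have h1 : LipschitzWith (Real.toNNReal (1 / (2 * p.h))) (regMin (shrink r p.δ 𝒦) p.h x₀) :=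
    LipschitzWith.of_dist_le_mul fun z z' => by
      have := H.h_pos
      rw [dist_eq_norm, dist_eq_norm, Real.coe_toNNReal _ (by positivity)]
      refine ((H.isRegMin_regMin z).norm_sub_le H.h_pos (H.isRegMin_regMin z')).trans_eq ?_
      ring
  exact h1.continuous.measurable.comp (H.measurable_avg_z hm)

omit [IsProbabilityMeasure μ] in
lemma radius_nonneg : 0 ≤ R := by
  have := H.shrink_subset_closedBall H.start_mem
  rw [mem_closedBall_zero_iff] at this
  exact (norm_nonneg _).trans this

omit [IsProbabilityMeasure μ] in
/-- A learner's centre is close to the leader: the conditional gradient error, the disagreement of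
the dual vectors, and the movement of the leader, because the call in block `m` uses dual
vectors that are one block old. -/
lemma norm_x_succ_sub_leader_le (i : Fin n) {m : ℕ} (hm : m ∈ Finset.Icc 1 p.K) (ω : Ω) :
    ‖e.x i (m + 1) ω - e.leader p 𝒦 r x₀ (m + 1) ω‖
      ≤ 4 * R / √p.K + (e.disagreement m ω / (2 * p.h)
        + ‖avg fun j => e.gHat p f j m ω‖ / (2 * p.h)) := by
  have hm' := Finset.mem_Icc.1 hm
  have hh := H.h_pos
  set y := regMin (shrink r p.δ 𝒦) p.h x₀ (e.z i m ω)
  have h1 : ‖e.x i (m + 1) ω - y‖ ≤ 4 * R / √p.K := by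
    rw [H.run.x_step m (by rwa [H.B_eq]), H.L_eq]
    have := ((H.cg_spec hm i ω).norm_sub_sq_le (convex_shrink H.decisionSet) H.h_pos
      H.shrink_subset_closedBall
      (H.x_mem i ω (Finset.mem_Icc.2 ⟨hm'.1, hm'.2.trans (Nat.le_succ _)⟩))
      (H.isRegMin_regMin _) H.K_pos)
    refine le_of_sq_le_sq (this.trans_eq ?_) (by have := H.radius_nonneg; positivity)
    rw [div_pow, Real.sq_sqrt (by positivity)]
  have h2 : ‖y - e.leader p 𝒦 r x₀ m ω‖ ≤ e.disagreement m ω / (2 * p.h) := by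
    refine ((H.isRegMin_regMin _).norm_sub_le hh (H.isRegMin_regMin _)).trans ?_
    exact div_le_div_of_nonneg_right
      (norm_le_stackNorm (fun i => e.z i m ω - avg fun j => e.z j m ω) i) (by positivity)
  have h3 : ‖e.leader p 𝒦 r x₀ m ω - e.leader p 𝒦 r x₀ (m + 1) ω‖
      ≤ ‖avg fun j => e.gHat p f j m ω‖ / (2 * p.h) := by
    refine ((H.isRegMin_regMin _).norm_sub_le hh (H.isRegMin_regMin _)).trans_eq ?_
    rw [H.avg_z_succ hm, sub_add_cancel_left, norm_neg]
  calc _ = ‖(e.x i (m + 1) ω - y) + ((y - e.leader p 𝒦 r x₀ m ω)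
        + (e.leader p 𝒦 r x₀ m ω - e.leader p 𝒦 r x₀ (m + 1) ω))‖ := by congr 1; abel
    _ ≤ _ := (norm_add_le _ _).trans (add_le_add h1 ((norm_add_le _ _).trans (add_le_add h2 h3)))

omit [IsProbabilityMeasure μ] in
lemma measurable_x_sub_leader (i : Fin n) {m : ℕ} (hm : m ∈ Finset.Icc 1 (p.K + 1)) :
    Measurable[e.ℋ ((m - 1) * p.K)] fun ω => e.x i m ω - e.leader p 𝒦 r x₀ m ω :=
  ((H.measurable_state hm).1 i).sub (H.measurable_leader hm)

omit [IsProbabilityMeasure μ] in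
lemma integrable_norm_x_sub_leader [IsFiniteMeasure μ] (i : Fin n) {m : ℕ}
    (hm : m ∈ Finset.Icc 1 (p.K + 1)) :
    Integrable (fun ω => ‖e.x i m ω - e.leader p 𝒦 r x₀ m ω‖) μ :=
  Integrable.of_bound (C := 2 * R)
    ((H.measurable_x_sub_leader i hm).mono (e.ℋ.le _) le_rfl).norm.aestronglyMeasurable
    (.of_forall fun ω => by
      rw [norm_norm]; exact H.norm_sub_le (H.x_mem i ω hm) (H.leader_mem m ω))

/-- The expected distance of a centre from the leader. In the first block it is zero, as both are
at `x₀`. -/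
lemma integral_norm_x_sub_leader_le (i : Fin n) {m : ℕ} (hm : m ∈ Finset.Icc 1 (p.K + 1)) :
    ∫ ω, ‖e.x i m ω - e.leader p 𝒦 r x₀ m ω‖ ∂μ
      ≤ 4 * R / √p.K + √n * blockBound d G M p / ((1 - sigma2 P) * p.h) := by
  have hσ : 0 < 1 - sigma2 P := by linarith [H.weight.gap]
  have hσ1 : 1 - sigma2 P ≤ 1 := by linarith [sigma2_nonneg P]
  have hA := H.blockBound_nonneg
  have hh := H.h_pos
  have hR := H.radius_nonneg
  obtain ⟨hm1, hm2⟩ := Finset.mem_Icc.1 hm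
  obtain rfl | ⟨k, rfl⟩ : m = 1 ∨ ∃ k, m = k + 1 + 1 := by
    rcases m with _ | _ | k
    · omega
    · exact Or.inl rfl
    · exact Or.inr ⟨k, rfl⟩
  · have : ∀ ω, e.leader p 𝒦 r x₀ 1 ω = x₀ := fun ω => by
      have h0 : (avg fun j => e.z j 1 ω) = 0 := by simp [avg, H.run.z_init]
      have h1 := H.isRegMin_regMin (0 : Vec d)
      rw [Execution.leader, h0]
      exact h1.eq_start hh H.start_mem
    simp only [this, H.run.x_init, sub_self, norm_zero, integral_zero]
    positivity
  · have hk : k + 1 ∈ Finset.Icc 1 p.K := Finset.mem_Icc.2 ⟨by omega, by omega⟩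
    obtain ⟨i1, b1⟩ := H.integral_disagreement_le (m := k + 1)
      (Finset.mem_Icc.2 ⟨by omega, by omega⟩)
    have i2 := (H.integrable_avg_gHat hk).1
    have b2 := H.integral_norm_avg_gHat_le hk
    have j1 := i1.div_const (2 * p.h)
    have j2 := i2.div_const (2 * p.h)
    refine (integral_mono (H.integrable_norm_x_sub_leader i hm)
      ((integrable_const _).add (j1.add j2)) (H.norm_x_succ_sub_leader_le i hk)).trans ?_
    rw [integral_add' (integrable_const _) (j1.add j2), integral_add' j1 j2, integral_const,
      integral_div, integral_div]
    rw [probReal_univ, one_smul]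
    have hn : 1 ≤ √(n : ℝ) := by
      rw [Real.one_le_sqrt]; exact_mod_cast Nat.one_le_iff_ne_zero.2 H.learners_pos
    have h1 : blockBound d G M p ≤ √n * blockBound d G M p / (1 - sigma2 P) := by
      rw [le_div_iff₀ hσ]
      calc blockBound d G M p * (1 - sigma2 P) ≤ blockBound d G M p :=
            mul_le_of_le_one_right hA hσ1
        _ ≤ _ := le_mul_of_one_le_left hA hn
    have h2 : √n * blockBound d G M p / ((1 - sigma2 P) * p.h)
        = (√n * blockBound d G M p / (1 - sigma2 P)) / (2 * p.h)
          + (√n * blockBound d G M p / (1 - sigma2 P)) / (2 * p.h) := by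
      field_simp; ring
    have h3 := div_le_div_of_nonneg_right b1 (show 0 ≤ 2 * p.h by positivity)
    have h4 := div_le_div_of_nonneg_right (b2.trans h1) (show 0 ≤ 2 * p.h by positivity)
    rw [h2]
    linarith

end IsRegularizedRun

/-! ### The expected regret -/

namespace IsRegularizedRun

variable {d n : ℕ} {Ω : Type*} [mΩ : MeasurableSpace Ω] {r R : ℝ} {G : NNReal} {M : ℝ}
  {μ : Measure Ω} [IsProbabilityMeasure μ] {p : Params} {E : Fin n → Fin n → Prop}
  {P : Matrix (Fin n) (Fin n) ℝ} {𝒦 : Set (Vec d)} {f : ℕ → Fin n → Vec d → ℝ} {x₀ : Vec d}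
  {e : Execution d n Ω} (H : IsRegularizedRun r R G M μ p E P 𝒦 f x₀ e)

include H

omit [IsProbabilityMeasure μ] in
lemma measurable_y (i : Fin n) {t : ℕ} (ht : t ∈ Finset.Icc 1 p.T) : Measurable (e.y p i t) :=
  ((H.measurable_x_past i ht).mono (e.ℋ.le _) le_rfl).add
    ((measurable_subtype_coe.comp
      ((H.run.u_history t ht i).mono (e.ℋ.le t) le_rfl)).const_smul p.δ)

lemma integrable_loss_y (i j : Fin n) {t : ℕ} (ht : t ∈ Finset.Icc 1 p.T) :
    Integrable (fun ω => f t j (e.y p i t ω)) μ :=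
  H.integrable_loss j ht (H.measurable_y i ht) fun ω => H.y_mem i ω ht

omit [IsProbabilityMeasure μ] in
lemma measurable_leader_sub {m : ℕ} (hm : m ∈ Finset.Icc 1 (p.K + 1)) (x : Vec d) :
    Measurable[e.ℋ ((m - 1) * p.K)] fun ω => e.leader p 𝒦 r x₀ m ω - x :=
  (H.measurable_leader hm).sub_const x

lemma integrable_norm_leader_sub {m : ℕ} (hm : m ∈ Finset.Icc 1 (p.K + 1)) {x : Vec d}
    (hx : x ∈ shrink r p.δ 𝒦) :
    Integrable (fun ω => ‖e.leader p 𝒦 r x₀ m ω - x‖) μ :=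
  Integrable.of_bound (C := 2 * R)
    ((H.measurable_leader_sub hm x).mono (e.ℋ.le _) le_rfl).norm.aestronglyMeasurable
    (.of_forall fun ω => by rw [norm_norm]; exact H.norm_sub_le (H.leader_mem m ω) hx)

/-- The loss that learner `i` suffers from the loss function of learner `j` in one round. Pairing
the estimate with the difference of centre and leader costs only `d G` times its mean norm, as both
are known before the round. -/
lemma integral_loss_y_le (i j : Fin n) {t : ℕ} (ht : t ∈ Finset.Icc 1 p.T) {x : Vec d}
    (hx : x ∈ 𝒦) :
    ∫ ω, f t j (e.y p i t ω) ∂μ ≤ f t j x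
      + ∫ ω, ⟪e.g p f j t ω, e.leader p 𝒦 r x₀ (p.blockOf t) ω - (1 - p.δ / r) • x⟫ ∂μ
      + (G * p.δ * (3 + R / r)
        + (d + 2) * G
          * (4 * R / √p.K + √n * blockBound d G M p / ((1 - sigma2 P) * p.h))) := by
  have hδ := H.δ_pos
  have hr : 0 < r := hδ.trans_le H.δ_le
  have hsub := shrink_subset H.decisionSet H.δ_pos H.δ_le
  set m := p.blockOf t
  set ρ := 4 * R / √p.K + √n * blockBound d G M p / ((1 - sigma2 P) * p.h)
  set x' := (1 - p.δ / r) • x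
  have hx' : x' ∈ shrink r p.δ 𝒦 := Set.smul_mem_smul_set hx
  obtain ⟨hmK, htm⟩ := H.blockOf_mem ht
  have hm : m ∈ Finset.Icc 1 (p.K + 1) :=
    Finset.Icc_subset_Icc_right (Nat.le_succ _) hmK
  have hpast : e.ℋ ((m - 1) * p.K) ≤ e.ℋ (t - 1) := e.ℋ.mono (H.mem_rounds hmK htm).2.2.1
  have hxm := fun k => (H.measurable_x_past k ht).mono (e.ℋ.le _) le_rfl
  have hlip := H.loss.lipschitz t ht j
  have ix := fun k => H.integrable_loss j ht (hxm k) fun ω => hsub (H.x_blockOf_mem k ht ω)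
  have iρ := fun k => H.integrable_norm_x_sub_leader (μ := μ) k hm
  have bρ := fun k => H.integral_norm_x_sub_leader_le k hm
  -- From the decision to the centre of learner `j`.
  have h1 : ∫ ω, f t j (e.y p i t ω) ∂μ
      ≤ ∫ ω, f t j (e.x j m ω) ∂μ + (G * (ρ + ρ) + G * p.δ) := by
    have hle : ∀ ω, f t j (e.y p i t ω) ≤ f t j (e.x j m ω)
        + (G * (‖e.x i m ω - e.leader p 𝒦 r x₀ m ω‖ + ‖e.x j m ω - e.leader p 𝒦 r x₀ m ω‖)
          + G * p.δ) := fun ω => by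
      have h2 := (abs_le.1 (hlip _ (H.y_mem i ω ht) _ (hsub (H.x_blockOf_mem j ht ω)))).2
      have h3 : ‖e.y p i t ω - e.x j m ω‖ ≤ (‖e.x i m ω - e.leader p 𝒦 r x₀ m ω‖
          + ‖e.x j m ω - e.leader p 𝒦 r x₀ m ω‖) + p.δ := by
        have h4 : e.y p i t ω - e.x j m ω = (e.x i m ω - e.leader p 𝒦 r x₀ m ω)
            - (e.x j m ω - e.leader p 𝒦 r x₀ m ω) + p.δ • (e.u i t ω : Vec d) := by
          rw [Execution.y]; abel
        rw [h4]
        refine (norm_add_le _ _).trans (add_le_add (norm_sub_le _ _) ?_)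
        rw [norm_smul, IsAdmissibleRun.norm_u, mul_one, Real.norm_of_nonneg hδ.le]
      have := mul_le_mul_of_nonneg_left h3 G.2
      change f t j (e.y p i t ω) - f t j (e.x j m ω) ≤ _ at h2
      have e5 : ((G : ℝ)) * ((‖e.x i m ω - e.leader p 𝒦 r x₀ m ω‖
          + ‖e.x j m ω - e.leader p 𝒦 r x₀ m ω‖) + p.δ)
          = G * (‖e.x i m ω - e.leader p 𝒦 r x₀ m ω‖ + ‖e.x j m ω - e.leader p 𝒦 r x₀ m ω‖)
          + G * p.δ := mul_add _ _ _
      change (G : ℝ) * _ ≤ (G : ℝ) * _ at this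
      linarith
    have i5 := ((iρ i).add (iρ j)).const_mul (G : ℝ)
    have i6 := i5.add (integrable_const ((G : ℝ) * p.δ))
    refine (integral_mono (H.integrable_loss_y i j ht) ((ix j).add i6) hle).trans ?_
    rw [integral_add' (ix j) i6, integral_add' i5 (integrable_const _), integral_const_mul,
      integral_add' (iρ i) (iρ j), integral_const, probReal_univ, one_smul]
    have := mul_le_mul_of_nonneg_left (add_le_add (bρ i) (bρ j)) G.2
    change (G : ℝ) * _ ≤ (G : ℝ) * _ at this
    linarith
  have h2 := H.integral_excess_le j ht hx'
  -- From the centre of learner `j` to the leader.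
  have h3 : ∫ ω, ⟪e.g p f j t ω, e.x j m ω - x'⟫ ∂μ
      ≤ d * G * ρ + ∫ ω, ⟪e.g p f j t ω, e.leader p 𝒦 r x₀ m ω - x'⟫ ∂μ := by
    have hY1 := (H.measurable_x_sub_leader j hm).mono hpast le_rfl
    have hY2 := (H.measurable_leader_sub hm x').mono hpast le_rfl
    have i1 := H.integrable_inner_g j ht (hY1.mono (e.ℋ.le _) le_rfl) (iρ j)
    have i2 := H.integrable_inner_g j ht (hY2.mono (e.ℋ.le _) le_rfl)
      (H.integrable_norm_leader_sub hm hx')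
    have e1 : ∀ ω, ⟪e.g p f j t ω, e.x j m ω - x'⟫
        = ⟪e.g p f j t ω, e.x j m ω - e.leader p 𝒦 r x₀ m ω⟫
          + ⟪e.g p f j t ω, e.leader p 𝒦 r x₀ m ω - x'⟫ := fun ω => by
      rw [← inner_add_right, sub_add_sub_cancel]
    simp only [e1]
    rw [integral_add i1 i2]
    have b1 := H.integral_inner_g_le j ht hY1 (iρ j)
    have b2 := mul_le_mul_of_nonneg_left (bρ j) (show 0 ≤ (d : ℝ) * G by positivity)
    linarith
  have h4 : f t j x' ≤ f t j x + G * (p.δ / r * R) := by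
    have h5 := (abs_le.1 (hlip x' (hsub hx') x hx)).2
    have h6 : ‖x' - x‖ ≤ p.δ / r * R := by
      have h7 : x' - x = -((p.δ / r) • x) := by simp only [x']; module
      rw [h7, norm_neg, norm_smul, Real.norm_of_nonneg (by positivity)]
      exact mul_le_mul_of_nonneg_left (by simpa using H.decisionSet.outer_ball hx)
        (by positivity)
    have h8 := mul_le_mul_of_nonneg_left h6 G.2
    change (G : ℝ) * _ ≤ (G : ℝ) * _ at h8
    linarith
  have e9 : G * p.δ * (3 + R / r) + (d + 2) * G * ρ
      = (G * (ρ + ρ) + G * p.δ) + 2 * G * p.δ + d * G * ρ + G * (p.δ / r * R) := by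
    field_simp; ring
  rw [e9]
  linarith

/-- The linearized regret of the leader. -/
lemma sum_integral_inner_leader_le {x : Vec d} (hx : x ∈ shrink r p.δ 𝒦) :
    ∑ t ∈ Finset.Icc 1 p.T, ∑ j, ∫ ω, ⟪e.g p f j t ω, e.leader p 𝒦 r x₀ (p.blockOf t) ω - x⟫ ∂μ
      ≤ n * (p.h * (2 * R) ^ 2 + p.K * blockBound d G M p ^ 2 / (4 * p.h)) := by
  have hh := H.h_pos
  have hn : (0 : ℝ) < n := by exact_mod_cast Nat.pos_of_ne_zero H.learners_pos
  have hblock : ∀ m ∈ Finset.Icc 1 p.K,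
      Integrable (fun ω => ⟪avg fun j => e.gHat p f j m ω, e.leader p 𝒦 r x₀ m ω - x⟫) μ ∧
      ∑ t ∈ p.rounds m, ∑ j, ∫ ω, ⟪e.g p f j t ω, e.leader p 𝒦 r x₀ (p.blockOf t) ω - x⟫ ∂μ
        = n * ∫ ω, ⟪avg fun j => e.gHat p f j m ω, e.leader p 𝒦 r x₀ m ω - x⟫ ∂μ := by
    intro m hm
    have hm' : m ∈ Finset.Icc 1 (p.K + 1) := Finset.Icc_subset_Icc_right (Nat.le_succ _) hm
    have hi : ∀ t ∈ p.rounds m, ∀ j,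
        Integrable (fun ω => ⟪e.g p f j t ω, e.leader p 𝒦 r x₀ m ω - x⟫) μ := fun t ht j =>
      H.integrable_inner_g j (H.mem_rounds hm ht).1
        ((H.measurable_leader_sub hm' x).mono (e.ℋ.le _) le_rfl)
        (H.integrable_norm_leader_sub hm' hx)
    have heq : ∀ ω, ∑ t ∈ p.rounds m, ∑ j, ⟪e.g p f j t ω, e.leader p 𝒦 r x₀ m ω - x⟫
        = n * ⟪avg fun j => e.gHat p f j m ω, e.leader p 𝒦 r x₀ m ω - x⟫ := fun ω => by
      rw [Finset.sum_comm, avg, inner_smul_left, conj_trivial, mul_inv_cancel_left₀ hn.ne',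
        sum_inner]
      refine Finset.sum_congr rfl fun j _ => ?_
      rw [Execution.gHat, sum_inner]
    have hint := integrable_finsetSum (μ := μ) (p.rounds m) fun t ht =>
      integrable_finsetSum Finset.univ fun j _ => hi t ht j
    simp only [heq] at hint
    refine ⟨?_, ?_⟩
    · have := hint.const_mul (n : ℝ)⁻¹
      simpa only [inv_mul_cancel_left₀ hn.ne'] using this
    · rw [← integral_const_mul]
      simp only [← heq]
      rw [integral_finsetSum _ fun t ht => integrable_finsetSum _ fun j _ => hi t ht j]
      refine Finset.sum_congr rfl fun t ht => ?_
      rw [integral_finsetSum _ fun j _ => hi t ht j, (H.mem_rounds hm ht).2.1]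
  rw [H.sum_rounds, Finset.sum_congr rfl fun m hm => (hblock m hm).2, ← Finset.mul_sum,
    ← integral_finsetSum _ fun m hm => (hblock m hm).1]
  refine mul_le_mul_of_nonneg_left ?_ hn.le
  have ia := fun m hm => ((H.integrable_avg_gHat (m := m) hm).2.1).div_const (4 * p.h)
  have hpath : ∀ ω, ∑ m ∈ Finset.Icc 1 p.K,
      ⟪avg fun j => e.gHat p f j m ω, e.leader p 𝒦 r x₀ m ω - x⟫
        ≤ p.h * (2 * R) ^ 2
          + ∑ m ∈ Finset.Icc 1 p.K, ‖avg fun j => e.gHat p f j m ω‖ ^ 2 / (4 * p.h) := by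
    intro ω
    refine (sum_inner_regMin_le (isCompact_shrink H.decisionSet) (convex_shrink H.decisionSet)
      hh H.start_mem (fun m => avg fun j => e.z j m ω) (fun m => avg fun j => e.gHat p f j m ω)
      p.K ?_ (fun m hm => H.avg_z_succ hm ω) hx).trans ?_
    · simp [avg, H.run.z_init]
    · have := pow_le_pow_left₀ (norm_nonneg _) (H.norm_sub_le hx H.start_mem) 2
      have := mul_le_mul_of_nonneg_left this hh.le
      linarith
  refine (integral_mono (integrable_finsetSum _ fun m hm => (hblock m hm).1)
    ((integrable_const _).add (integrable_finsetSum _ ia)) hpath).trans ?_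
  rw [integral_add' (integrable_const _) (integrable_finsetSum _ ia), integral_finsetSum _ ia,
    integral_const, probReal_univ, one_smul]
  refine add_le_add_right ?_ _
  refine (Finset.sum_le_card_nsmul _ _ (blockBound d G M p ^ 2 / (4 * p.h)) fun m hm => ?_).trans_eq
    (by rw [Nat.card_Icc, nsmul_eq_mul]; simp; ring)
  rw [integral_div]
  exact div_le_div_of_nonneg_right (H.integrable_avg_gHat hm).2.2 (by positivity)

/-- The expected regret, before the parameters are tuned. -/
theorem integral_regret_le (i : Fin n) :
    Integrable (fun ω => regret 𝒦 p.T f fun t => e.y p i t ω) μ ∧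
    ∫ ω, regret 𝒦 p.T f (fun t => e.y p i t ω) ∂μ
      ≤ p.T * (n * (G * p.δ * (3 + R / r) + (d + 2) * G
          * (4 * R / √p.K + √n * blockBound d G M p / ((1 - sigma2 P) * p.h))))
        + n * (p.h * (2 * R) ^ 2 + p.K * blockBound d G M p ^ 2 / (4 * p.h)) := by
  set Q := G * p.δ * (3 + R / r) + (d + 2) * G
          * (4 * R / √p.K + √n * blockBound d G M p / ((1 - sigma2 P) * p.h))
  set Q' := p.h * (2 * R) ^ 2 + p.K * blockBound d G M p ^ 2 / (4 * p.h)
  have hg : ∀ t ∈ Finset.Icc 1 p.T, Integrable (fun ω => globalLoss f t (e.y p i t ω)) μ :=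
    fun t ht => integrable_finsetSum _ fun j _ => H.integrable_loss_y i j ht
  have hi := integrable_finsetSum _ hg
  refine ⟨hi.sub (integrable_const _), ?_⟩
  simp only [regret]
  rw [integral_sub hi (integrable_const _), integral_const, probReal_univ, one_smul,
    sub_le_comm]
  have hne : 𝒦.Nonempty := ⟨0, H.decisionSet.inner_ball
    (Metric.mem_closedBall_self (H.δ_pos.le.trans H.δ_le))⟩
  refine le_csInf (hne.image _) ?_
  rintro _ ⟨x, hx, rfl⟩
  rw [sub_le_iff_le_add, integral_finsetSum _ hg]
  have h1 : ∀ t ∈ Finset.Icc 1 p.T, ∫ ω, globalLoss f t (e.y p i t ω) ∂μ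
      ≤ globalLoss f t x + ∑ j, ∫ ω, ⟪e.g p f j t ω,
        e.leader p 𝒦 r x₀ (p.blockOf t) ω - (1 - p.δ / r) • x⟫ ∂μ + n * Q := fun t ht => by
    simp only [globalLoss]
    rw [integral_finsetSum _ fun j _ => H.integrable_loss_y i j ht]
    refine (Finset.sum_le_sum fun j _ => H.integral_loss_y_le i j ht hx).trans_eq ?_
    rw [Finset.sum_add_distrib, Finset.sum_add_distrib]
    simp only [Finset.sum_const, Finset.card_univ, Fintype.card_fin, nsmul_eq_mul, Q]
  have h2 := H.sum_integral_inner_leader_le (Set.smul_mem_smul_set (a := 1 - p.δ / r) hx)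
  refine (Finset.sum_le_sum h1).trans ?_
  rw [Finset.sum_add_distrib, Finset.sum_add_distrib]
  simp only [Finset.sum_const, Nat.card_Icc, nsmul_eq_mul, Nat.add_sub_cancel]
  linarith

end IsRegularizedRun

/-! ### Tuning the parameters -/

section conclusion

variable {d n : ℕ} {Ω : Type*} [mΩ : MeasurableSpace Ω] {r R : ℝ} {G : NNReal} {M : ℝ}
  {μ : Measure Ω} {p : Params} {E : Fin n → Fin n → Prop} {P : Matrix (Fin n) (Fin n) ℝ}
  {𝒦 : Set (Vec d)} {f : ℕ → Fin n → Vec d → ℝ} {x₀ : Vec d} {e : Execution d n Ω}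

/-- Messages are only sent in the rounds `K, 2 K, …, K²`. -/
lemma ncard_commRounds_le (hK : 1 ≤ p.K) (hT : p.T = p.K * p.K) :
    (e.commRounds p E).ncard ≤ p.K := by
  have hsub : e.commRounds p E ⊆ ((Finset.Icc 1 p.K).image (· * p.K) : Finset ℕ) := by
    rintro t ⟨ht, j, i, ω, hmsg⟩
    have hdvd : p.K ∣ t := by
      by_contra h
      exact hmsg (by simp [Execution.msg, h])
    obtain ⟨k, rfl⟩ := hdvd
    obtain ⟨h1, h2⟩ := Finset.mem_Icc.1 ht
    rw [hT] at h2
    rw [Finset.coe_image]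
    refine ⟨k, Finset.mem_coe.2 (Finset.mem_Icc.2 ⟨?_, ?_⟩), mul_comm _ _⟩
    · exact Nat.pos_of_mul_pos_left h1
    · exact Nat.le_of_mul_le_mul_left h2 hK
  calc _ ≤ ((Finset.Icc 1 p.K).image (· * p.K)).card := by
        rw [← Set.ncard_coe_finset]
        exact Set.ncard_le_ncard hsub (Finset.finite_toSet _)
    _ ≤ p.K := Finset.card_image_le.trans (by simp)

/-- If the losses are bounded by `0`, the regret vanishes. -/
lemma IsAdmissibleRun.regret_eq_zero (H : IsAdmissibleRun r R G 0 μ p E P 𝒦 f x₀ e)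
    (i : Fin n) (ω : Ω) : regret 𝒦 p.T f (fun t => e.y p i t ω) = 0 := by
  have h0 : ∀ t ∈ Finset.Icc 1 p.T, ∀ x ∈ 𝒦, globalLoss f t x = 0 := fun t ht x hx =>
    Finset.sum_eq_zero fun j _ => abs_nonpos_iff.1 (H.loss.bounded t ht j x hx)
  have hne : 𝒦.Nonempty := ⟨0, H.decisionSet.inner_ball
    (Metric.mem_closedBall_self (H.δ_pos.le.trans H.δ_le))⟩
  have h1 : (fun x => ∑ t ∈ Finset.Icc 1 p.T, globalLoss f t x) '' 𝒦 = {0} := by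
    refine Set.Subset.antisymm ?_ ?_
    · rintro _ ⟨x, hx, rfl⟩
      exact Finset.sum_eq_zero fun t ht => h0 t ht x hx
    · obtain ⟨x, hx⟩ := hne
      rintro _ rfl
      exact ⟨x, hx, Finset.sum_eq_zero fun t ht => h0 t ht x hx⟩
  rw [regret, h1, csInf_singleton, sub_zero]
  exact Finset.sum_eq_zero fun t ht => h0 t ht _ (H.y_mem i ω ht)

/-- The constant of the regret bound. -/
noncomputable def regretConst (d : ℕ) (G : NNReal) (M r R c : ℝ) : ℝ :=
  G * c * (3 + R / r) + (d + 2) * G * (4 * R) + (d + 2) * G * (d * M / c + d * G) * R / (d * M)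
    + d * M * (4 * R) + (d * M / c + d * G) ^ 2 * R / (4 * (d * M))

lemma regretConst_nonneg (hM : 0 ≤ M) (hr : 0 < r) (hR : 0 < R) {c : ℝ} (hc : 0 < c) :
    0 ≤ regretConst d G M r R c := by
  unfold regretConst; positivity

/-- The tuning: with `q = T ^ (1/4)`, `ν = n ^ (1/4)` and `s = √(1 - σ₂(P))`, every term of the
regret bound is at most a constant times `ν ^ 5 q ^ 3 / s`. -/
lemma tuned_bound_le {c q ν s : ℝ} (hd : 1 ≤ d) (hM : 0 < M) (hr : 0 < r) (hR : 0 < R)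
    (hc : 0 < c) (hq : 0 < q) (hν : 1 ≤ ν) (hs : 0 < s) (hs1 : s ≤ 1) :
    q ^ 4 * (ν ^ 4 * (G * (c / q) * (3 + R / r) + (d + 2) * G
          * (4 * R / q + ν ^ 2 * (q * (d / (c / q) * M) + q ^ 2 * (d * G))
            / (s ^ 2 * (ν * d * M * q ^ 3 / (s * R))))))
        + ν ^ 4 * (ν * d * M * q ^ 3 / (s * R) * (2 * R) ^ 2
          + q ^ 2 * (q * (d / (c / q) * M) + q ^ 2 * (d * G)) ^ 2
            / (4 * (ν * d * M * q ^ 3 / (s * R))))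
      ≤ regretConst d G M r R c * (ν ^ 5 * s⁻¹ * q ^ 3) := by
  have hd0 : (0 : ℝ) < d := by exact_mod_cast hd
  have hν0 : 0 < ν := by linarith
  have e1 : q ^ 4 * (ν ^ 4 * (G * (c / q) * (3 + R / r) + (d + 2) * G
          * (4 * R / q + ν ^ 2 * (q * (d / (c / q) * M) + q ^ 2 * (d * G))
            / (s ^ 2 * (ν * d * M * q ^ 3 / (s * R))))))
        + ν ^ 4 * (ν * d * M * q ^ 3 / (s * R) * (2 * R) ^ 2
          + q ^ 2 * (q * (d / (c / q) * M) + q ^ 2 * (d * G)) ^ 2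
            / (4 * (ν * d * M * q ^ 3 / (s * R))))
      = (G * c * (3 + R / r) + (d + 2) * G * (4 * R)) * (ν ^ 4 * q ^ 3)
        + ((d + 2) * G * (d * M / c + d * G) * R / (d * M) + d * M * (4 * R))
          * (ν ^ 5 * s⁻¹ * q ^ 3)
        + (d * M / c + d * G) ^ 2 * R / (4 * (d * M)) * (ν ^ 3 * s * q ^ 3) := by
    field_simp
    ring
  have hs' : 1 ≤ s⁻¹ := (one_le_inv₀ hs).2 hs1
  have h45 : ν ^ 4 ≤ ν ^ 5 := pow_le_pow_right₀ hν (by norm_num)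
  have h35 : ν ^ 3 ≤ ν ^ 5 := pow_le_pow_right₀ hν (by norm_num)
  have b1 : ν ^ 4 * q ^ 3 ≤ ν ^ 5 * s⁻¹ * q ^ 3 :=
    mul_le_mul_of_nonneg_right (h45.trans (le_mul_of_one_le_right (by positivity) hs'))
      (by positivity)
  have b2 : ν ^ 3 * s * q ^ 3 ≤ ν ^ 5 * s⁻¹ * q ^ 3 :=
    mul_le_mul_of_nonneg_right
      (mul_le_mul h35 (hs1.trans hs') hs.le (by positivity)) (by positivity)
  rw [e1, regretConst]
  have c1 := mul_le_mul_of_nonneg_left b1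
    (show 0 ≤ G * c * (3 + R / r) + (d + 2) * G * (4 * R) by positivity)
  have c2 := mul_le_mul_of_nonneg_left b2
    (show 0 ≤ (d * M / c + d * G) ^ 2 * R / (4 * (d * M)) by positivity)
  linarith

end conclusion

end BanditCG

theorem theorem6 (d : ℕ) (hd : 1 ≤ d) (G M r R c : ℝ) (hr : 0 < r) (hR : 0 < R) (hc : 0 < c) :
    ∃ C : ℝ, ∀ (n : ℕ) (E : Fin n → Fin n → Prop) (P : Matrix (Fin n) (Fin n) ℝ)
      (𝒦 : Set (BanditCG.Vec d)) (f : ℕ → Fin n → BanditCG.Vec d → ℝ) (x₀ : BanditCG.Vec d)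
      (p : BanditCG.Params) (Ω : Type*) (_ : MeasurableSpace Ω) (μ : Measure Ω)
      (e : BanditCG.Execution d n Ω),
      IsProbabilityMeasure μ →
      BanditCG.IsDecisionSet r R 𝒦 →
      BanditCG.IsWeightMatrix E P →
      BanditCG.IsLossSequence 𝒦 G M p.T f →
      1 ≤ p.T →
      p.α = 0 →
      (p.K : ℝ) = √(p.T : ℝ) →
      (p.L : ℝ) = √(p.T : ℝ) →
      p.h = (n : ℝ) ^ (1 / 4 : ℝ) * d * M * (p.T : ℝ) ^ (3 / 4 : ℝ)
        / (√(1 - BanditCG.sigma2 P) * R) →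
      p.δ = c * (p.T : ℝ) ^ (-(1 / 4) : ℝ) →
      p.δ ≤ r →
      x₀ ∈ BanditCG.shrink r p.δ 𝒦 →
      e.IsDBBCG μ p E P 𝒦 r f x₀ →
      (∀ i : Fin n,
        Integrable (fun ω => BanditCG.regret 𝒦 p.T f (fun t => e.y p i t ω)) μ ∧
        ∫ ω, BanditCG.regret 𝒦 p.T f (fun t => e.y p i t ω) ∂μ
          ≤ C * ((n : ℝ) ^ (5 / 4 : ℝ) * (1 - BanditCG.sigma2 P) ^ (-(1 / 2) : ℝ)
            * (p.T : ℝ) ^ (3 / 4 : ℝ))) ∧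
      ((e.commRounds p E).ncard : ℝ) ≤ √(p.T : ℝ) := by
  refine ⟨BanditCG.regretConst d G.toNNReal M r R c, ?_⟩
  intro n E P 𝒦 f x₀ p Ω _ μ e hμ h𝒦 hP hf hT1 hα hK hL hh hδ hδr hx₀ hrun
  have hT0 : (0 : ℝ) < p.T := by exact_mod_cast hT1
  have hKpos : 1 ≤ p.K := by
    have : (0 : ℝ) < p.K := by rw [hK]; positivity
    exact_mod_cast this
  have hTK : p.T = p.K * p.K := by
    have : (p.T : ℝ) = p.K * p.K := by rw [hK, Real.mul_self_sqrt hT0.le]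
    exact_mod_cast this
  refine ⟨fun i => ?_, ?_⟩
  swap
  · rw [← hK]; exact_mod_cast BanditCG.ncard_commRounds_le hKpos hTK
  have hδ0 : 0 < p.δ := by rw [hδ]; positivity
  have hn : n ≠ 0 := fun h => by subst h; exact i.elim0
  have hf' : BanditCG.IsLossSequence 𝒦 G.toNNReal M p.T f :=
    ⟨hf.convex, fun t ht i x hx y hy => (hf.lipschitz t ht i x hx y hy).trans
      (mul_le_mul_of_nonneg_right (Real.le_coe_toNNReal G) (norm_nonneg _)), hf.bounded⟩
  have hM : 0 ≤ M := (abs_nonneg _).trans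
    (hf.bounded 1 (Finset.mem_Icc.2 ⟨le_rfl, hT1⟩) i 0
      (h𝒦.inner_ball (Metric.mem_closedBall_self hr.le)))
  have hLK : p.L = p.K := by
    have : (p.L : ℝ) = p.K := by rw [hK, hL]
    exact_mod_cast this
  have H : BanditCG.IsAdmissibleRun r R G.toNNReal M μ p E P 𝒦 f x₀ e :=
    ⟨hd, hn, h𝒦, hP, hf', hrun, hx₀, hKpos, hLK, hTK, hα, hδ0, hδr⟩
  have hσ : 0 < 1 - BanditCG.sigma2 P := by linarith [hP.gap]
  -- Fourth roots turn all powers in the bound into integral ones.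
  set q : ℝ := (p.T : ℝ) ^ (1 / 4 : ℝ) with hq
  set ν : ℝ := (n : ℝ) ^ (1 / 4 : ℝ) with hν
  set s : ℝ := √(1 - BanditCG.sigma2 P) with hs
  have hn0 : (0 : ℝ) < n := by exact_mod_cast Nat.pos_of_ne_zero hn
  have hq0 : 0 < q := by positivity
  have hν1 : 1 ≤ ν := Real.one_le_rpow (by exact_mod_cast Nat.one_le_iff_ne_zero.2 hn) (by norm_num)
  have hs0 : 0 < s := Real.sqrt_pos.2 hσ
  have hs1 : s ≤ 1 := Real.sqrt_le_one.2 (by linarith [BanditCG.sigma2_nonneg P])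
  have hqpow : ∀ k : ℕ, q ^ k = (p.T : ℝ) ^ ((k : ℝ) / 4) := fun k => by
    rw [hq, ← Real.rpow_mul_natCast hT0.le]; congr 1; ring
  have hνpow : ∀ k : ℕ, ν ^ k = (n : ℝ) ^ ((k : ℝ) / 4) := fun k => by
    rw [hν, ← Real.rpow_mul_natCast hn0.le]; congr 1; ring
  have hq4 : (p.T : ℝ) = q ^ 4 := by rw [hqpow]; norm_num
  have hq3 : (p.T : ℝ) ^ (3 / 4 : ℝ) = q ^ 3 := by rw [hqpow]; norm_num
  have hqinv : (p.T : ℝ) ^ (-(1 / 4) : ℝ) = q⁻¹ := by rw [Real.rpow_neg hT0.le]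
  have hKq : (p.K : ℝ) = q ^ 2 := by
    rw [hK, hq4, show q ^ 4 = (q ^ 2) ^ 2 by ring, Real.sqrt_sq (by positivity)]
  have hsK : √(p.K : ℝ) = q := by rw [hKq, Real.sqrt_sq hq0.le]
  have hν4 : (n : ℝ) = ν ^ 4 := by rw [hνpow]; norm_num
  have hν5 : (n : ℝ) ^ (5 / 4 : ℝ) = ν ^ 5 := by rw [hνpow]; norm_num
  have hsn : √(n : ℝ) = ν ^ 2 := by
    rw [hν4, show ν ^ 4 = (ν ^ 2) ^ 2 by ring, Real.sqrt_sq (by positivity)]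
  have hs2 : 1 - BanditCG.sigma2 P = s ^ 2 := (Real.sq_sqrt hσ.le).symm
  have hsinv : (1 - BanditCG.sigma2 P) ^ (-(1 / 2) : ℝ) = s⁻¹ := by
    rw [Real.rpow_neg hσ.le, hs, Real.sqrt_eq_rpow]
  rw [hν5, hsinv, hq3]
  rcases hM.eq_or_lt with rfl | hM
  · simp only [H.regret_eq_zero i, integral_zero]
    exact ⟨integrable_const _, mul_nonneg (BanditCG.regretConst_nonneg le_rfl hr hR hc)
      (by positivity)⟩
  have hh' : p.h = ν * d * M * q ^ 3 / (s * R) := by rw [hh, hq3]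
  have hδ' : p.δ = c / q := by rw [hδ, hqinv, div_eq_mul_inv]
  have hhpos : 0 < p.h := by
    have : (0 : ℝ) < d := by exact_mod_cast hd
    rw [hh']; positivity
  obtain ⟨hint, hle⟩ := BanditCG.IsRegularizedRun.integral_regret_le ⟨H, hhpos⟩ i
  refine ⟨hint, hle.trans ?_⟩
  rw [BanditCG.blockBound, hsK, hsn, hKq, hq4, hs2, hh', hδ', hν4]
  exact BanditCG.tuned_bound_le hd hM hr hR hc hq0 hν1 hs0 hs1
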